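/- Let $\mathcal H^s$ denote $s$-dimensional Hausdorff measure on $\mathbb C$. A gauge function is a continuous non-decreasing $h:[0,\infty)\to[0,\infty)$ with $h(t)\to 0$ as $t\to0$ and $h(t)>0$ for $t>0$; $\mathcal H^h$ denotes the Hausdorff measure with gauge $h$, i.e. $\mathcal H^h(A)=\lim_{\delta\to0}\inf\sum_j h(\operatorname{diam}A_j)$ over countable covers $(A_j)$ of $A$ by sets of diameter at most $\delta$. For $K\ge1$, a $K$-quasiconformal mapping $\varphi:\mathbb C\to\mathbb C$ is an orientation preserving homeomorphism in $W^{1,2}_{loc}(\mathbb C)$ with $\max_\alpha|\partial_\alpha\varphi|\le K\min_\alpha|\partial_\alpha\varphi|$ almost everywhere. Corollary 3.3. The implication "$\mathcal H^{2/(K+1)}(E)=0\Rightarrow\mathcal H^1(\varphi(E))=0$ for all compact $E\subset\mathbb C$ and all $K$-quasiconformal $\varphi$" has a sharp hypothesis: no relaxation of the hypothesis in terms of gauge functions allows the same conclusion. More precisely, for every $K\ge1$ there exist a compact set $E\subset\mathbb C$ and a $K$-quasiconformal mapping $\varphi:\mathbb C\to\mathbb C$ such that $$0<\mathcal H^{2/(K+1)}(E)<\infty,\qquad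 0<\mathcal H^{1}(\varphi(E))<\infty,$$ and such that $\mathcal H^h(E)=0$ for every gauge function $h$ with $h(t)/t^{2/(K+1)}\to0$ as $t\to0^+$ (so that for each such $h$ the hypothesis $\mathcal H^h(E)=0$ does not imply $\mathcal H^1(\varphi(E))=0$). -/

import Mathlib

open MeasureTheory Filter Topology
open scoped NNReal ENNReal ContDiff

/-- `D` is the (total) weak derivative of `f : ℂ → ℂ` on the whole plane: both are locally
integrable and `∫ (∂_v η) f = -∫ η (D v)` for all real smooth compactly supported test functions
`η` and all directions `v`. Thus `D z v` is the weak directional derivative `∂_v f (z)`. -/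
def HasWeakFDeriv (f : ℂ → ℂ) (D : ℂ → ℂ →L[ℝ] ℂ) : Prop :=
  LocallyIntegrable f ∧ LocallyIntegrable D ∧
    ∀ η : ℂ → ℝ, ContDiff ℝ ∞ η → HasCompactSupport η → ∀ v : ℂ,
      ∫ z, (fderiv ℝ η z v) • f z = - ∫ z, (η z) • (D z v)

/-- `f` is square integrable on every compact set. -/
def MemL2Loc {F : Type*} [NormedAddCommGroup F] (f : ℂ → F) : Prop :=
  ∀ S : Set ℂ, IsCompact S → MemLp f 2 (volume.restrict S)

/-- Positive orientation of a homeomorphism `φ` of the plane: for every circle with centre `a` and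
radius `r`, the image of the circle, traversed once counterclockwise, winds exactly once
counterclockwise around `φ a`. The winding number is read off from a continuous branch `g` of
`log (φ (a + r e^{iθ}) - φ a)` along the circle. -/
def OrientationPreserving (φ : ℂ → ℂ) : Prop :=
  ∀ (a : ℂ) (r : ℝ), 0 < r → ∃ g : ℝ → ℂ, Continuous g ∧
    (∀ θ : ℝ, Complex.exp (g θ) = φ (a + r * Complex.exp (θ * Complex.I)) - φ a) ∧
    g (2 * Real.pi) = g 0 + 2 * Real.pi * Complex.I

/-- `φ : ℂ → ℂ` is `K`-quasiconformal: an orientation preserving homeomorphism of the plane in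
`W^{1,2}_loc(ℂ)` with `max_α |∂_α φ| ≤ K min_α |∂_α φ|` almost everywhere, where
`∂_α φ (z) = D z (e^{iα})` is the derivative in the direction of angle `α`. -/
def IsQuasiconformal (K : ℝ) (φ : ℂ → ℂ) : Prop :=
  IsHomeomorph φ ∧ OrientationPreserving φ ∧ MemL2Loc φ ∧
    ∃ D : ℂ → ℂ →L[ℝ] ℂ, HasWeakFDeriv φ D ∧ MemL2Loc D ∧
      ∀ᵐ z : ℂ, ∀ α β : ℝ,
        ‖D z (Complex.exp (α * Complex.I))‖ ≤ K * ‖D z (Complex.exp (β * Complex.I))‖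

/-- A gauge (measure) function: continuous, non-decreasing on `[0, ∞)`, tending to `0` at `0`,
positive at positive arguments. -/
structure IsGaugeFunction (h : ℝ≥0 → ℝ≥0) : Prop where
  continuous : Continuous h
  monotone : Monotone h
  tendsto_zero : Tendsto h (𝓝[>] 0) (𝓝 0)
  pos : ∀ t, 0 < t → 0 < h t

/-- The generalized Hausdorff measure with gauge function `h` on the plane,
`lim_{δ → 0} inf { ∑ h (diam A_j) : (A_j) a countable cover by sets of diameter at most δ }`.
Only sets of small diameter matter, so the value of `ENNReal.toNNReal` at `∞` plays no role. -/
noncomputable def gaugeHausdorffMeasure (h : ℝ≥0 → ℝ≥0) : Measure ℂ :=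
  Measure.mkMetric fun x : ℝ≥0∞ => (h x.toNNReal : ℝ≥0∞)

/-! Choose finite disjoint packings `P 0, P 1, …` of the unit disc by discs of radius at most `1/2`
whose areas tend to the full area fast enough that the nested discs obtained by iterating them
converge to a set of positive area. For `p > 1`, replace in each step every disc `B(c, r)` of the
packing by the smaller concentric disc `B(c, r ^ p)`; the same iteration then gives a Cantor set
`E_p`. Since `∑ r ^ 2 ≤ 1`, the radii of each generation satisfy `∑ ρ ^ (2 / p) ≤ 1`, so the
`2 / p`-dimensional measure of `E_p` is finite; it is positive because the area on `E_1`, carried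
over to `E_p`, gives a set of diameter `d` mass at most a constant times `d ^ (2 / p)`.

If `p - 1 = K (q - 1)`, the radial stretching of the annulus `r ^ p ≤ |z - c| ≤ r` onto
`r ^ q ≤ |z - c| ≤ r` is `|w| ^ (1 / K - 1) w` up to scaling, hence `K`-quasiconformal, and it is
conformal on the inner disc, where the construction is repeated. The iterates converge uniformly
to a homeomorphism taking `E_p` to `E_q`. They agree with it off the `m`-th generation of discs,
whose area tends to `0`, so that their derivatives converge locally in `L¹` and the limit is
`K`-quasiconformal. With `q = 2`, `p = K + 1` the dimensions are `2 / (K + 1)` and `1`. Finally, a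
set of finite `s`-dimensional measure is null for every gauge that is `o(t ^ s)`. -/

section Orientation

theorem sub_eq_sub_of_exp_eq_exp {X : Type*} [TopologicalSpace X] [PreconnectedSpace X]
    {u v : X → ℂ} (hu : Continuous u) (hv : Continuous v)
    (h : ∀ x, Complex.exp (u x) = Complex.exp (v x)) (x y : X) : u x - v x = u y - v y := by
  choose n hn using fun x => Complex.exp_eq_exp_iff_exists_int.1 (h x)
  have hn' : ∀ x, (n x : ℂ) = (u x - v x) / (2 * Real.pi * Complex.I) := fun x => by
    rw [hn, add_sub_cancel_left, mul_div_cancel_right₀ _ Complex.two_pi_I_ne_zero]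
  have hcont : Continuous n := by
    refine Int.isClosedEmbedding_coe_real.isEmbedding.continuous_iff.2 ?_
    have : Continuous fun x => ((u x - v x) / (2 * Real.pi * Complex.I)).re := by fun_prop
    exact this.congr fun x => by rw [← hn', Complex.intCast_re, Function.comp_apply]
  rw [hn x, hn y, PreconnectedSpace.constant inferInstance hcont (x := x) (y := y)]
  ring

theorem exists_continuous_exp_eq {G : ℝ × ℝ → ℂ} (hG : Continuous G) (h0 : ∀ x, G x ≠ 0) :
    ∃ g : ℝ × ℝ → ℂ, Continuous g ∧ ∀ x, Complex.exp (g x) = G x := by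
  obtain ⟨F, ⟨-, hF⟩, -⟩ := Complex.isCoveringMapOn_exp.existsUnique_continuousMap_lifts
    (f := (⟨G, hG⟩ : C(ℝ × ℝ, ℂ))) (a₀ := (0, 0)) (e₀ := Complex.log (G (0, 0)))
    (Complex.exp_log (h0 _)) (fun x => h0 x)
  exact ⟨F, F.continuous, fun x => congrFun hF x⟩

theorem exists_log_on_large_circle {φ : ℂ → ℂ} (hφ : Continuous φ) {M : ℝ}
    (hM : ∀ z, ‖φ z - z‖ ≤ M) (a : ℂ) {s : ℝ} (hs : 2 * M < Real.exp s) :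
    ∃ u : ℝ → ℂ, Continuous u ∧
      (∀ θ : ℝ, Complex.exp (u θ) = φ (a + Complex.exp (s + θ * Complex.I)) - φ a) ∧
      u (2 * Real.pi) = u 0 + 2 * Real.pi * Complex.I := by
  set e : ℝ → ℂ := fun θ => Complex.exp (s + θ * Complex.I) with he
  have he0 : ∀ θ, e θ ≠ 0 := fun θ => Complex.exp_ne_zero _
  set q : ℝ → ℂ := fun θ => (φ (a + e θ) - (a + e θ) - (φ a - a)) / e θ with hq
  have hslit : ∀ θ, 1 + q θ ∈ Complex.slitPlane := fun θ => by
    refine Complex.mem_slitPlane_of_norm_lt_one ?_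
    have hnorm : ‖e θ‖ = Real.exp s := by simp [he, Complex.norm_exp]
    rw [hq, norm_div, hnorm, div_lt_one (Real.exp_pos _)]
    linarith [norm_sub_le (φ (a + e θ) - (a + e θ)) (φ a - a), hM (a + e θ), hM a]
  have hecont : Continuous e := by fun_prop
  have hqcont : Continuous q := Continuous.div (by fun_prop) hecont he0
  have hperiod : e (2 * Real.pi) = e 0 := by simp [he, Complex.exp_add, Complex.exp_two_pi_mul_I]
  refine ⟨fun θ => s + θ * Complex.I + Complex.log (1 + q θ),
    Continuous.add (by fun_prop) ((continuous_const.add hqcont).clog hslit), fun θ => ?_, ?_⟩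
  · rw [Complex.exp_add, Complex.exp_log (Complex.slitPlane_ne_zero (hslit θ))]
    change e θ * (1 + q θ) = φ (a + e θ) - φ a
    rw [mul_add, hq, mul_div_cancel₀ _ (he0 θ)]
    ring
  · simp only [hq, hperiod]
    push_cast
    ring

/-- The winding number around `φ a` does not depend on the radius, and on a large circle `φ` is a
small relative perturbation of the identity. -/
theorem orientationPreserving_of_norm_sub_le {φ : ℂ → ℂ} (hφ : Continuous φ)
    (hinj : Function.Injective φ) {M : ℝ} (hM : ∀ z, ‖φ z - z‖ ≤ M) : OrientationPreserving φ := by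
  intro a r hr
  obtain ⟨g, hg, hexp⟩ := exists_continuous_exp_eq
    (G := fun x => φ (a + Complex.exp (x.1 + x.2 * Complex.I)) - φ a) (by fun_prop) fun x hx => by
      simpa using hinj (sub_eq_zero.1 hx)
  have hperiod := sub_eq_sub_of_exp_eq_exp (u := fun x : ℝ × ℝ => g (x.1, x.2 + 2 * Real.pi))
    (by fun_prop) hg (fun x => by
      simp [hexp, add_mul, ← add_assoc, Complex.exp_add _ (2 * Real.pi * Complex.I),
        Complex.exp_two_pi_mul_I])
  obtain ⟨s, hs⟩ := (Real.tendsto_exp_atTop.eventually_gt_atTop (2 * M)).exists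
  obtain ⟨u, hu, huexp, huperiod⟩ := exists_log_on_large_circle hφ hM a hs
  have hlarge := sub_eq_sub_of_exp_eq_exp (u := fun θ : ℝ => g (s, θ)) (by fun_prop) hu
    (fun θ => by rw [hexp, huexp]) (2 * Real.pi) 0
  refine ⟨fun θ => g (Real.log r, θ), by fun_prop, fun θ => ?_, ?_⟩
  · rw [hexp, Complex.exp_add, ← Complex.ofReal_exp, Real.exp_log hr]
  · have hradius := hperiod (Real.log r, 0) (s, 0)
    simp only [zero_add] at hradius
    linear_combination hradius + hlarge + huperiod

end Orientation

/-- A finite packing of the unit disc by pairwise disjoint closed discs of radius at most `1/2`,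
indexed by their centres; `radius` is meaningful only at the centres. -/
structure DiscPacking where
  centers : Finset ℂ
  radius : ℂ → ℝ
  radius_pos : ∀ c ∈ centers, 0 < radius c
  radius_le : ∀ c ∈ centers, radius c ≤ 1 / 2
  disjoint : ∀ c ∈ centers, ∀ c' ∈ centers, c ≠ c' → radius c + radius c' < dist c c'
  norm_add_radius_le : ∀ c ∈ centers, ‖c‖ + radius c ≤ 1

theorem volume_closedBall_complex (c : ℂ) {r : ℝ} (hr : 0 ≤ r) :
    volume (Metric.closedBall c r) = ENNReal.ofReal (Real.pi * r ^ 2) := by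
  rw [Complex.volume_closedBall, ← ENNReal.ofReal_pow hr, mul_comm,
    ENNReal.ofReal_mul Real.pi_pos.le]
  congr 1
  rw [← NNReal.coe_real_pi, ENNReal.ofReal_coe_nnreal]

namespace DiscPacking

variable (P : DiscPacking)

theorem closedBall_subset {c : ℂ} (hc : c ∈ P.centers) :
    Metric.closedBall c (P.radius c) ⊆ Metric.closedBall 0 1 := by
  refine Metric.closedBall_subset_closedBall' ?_
  rw [dist_zero_right, add_comm]
  exact P.norm_add_radius_le c hc

theorem eq_of_mem_closedBall {c c' z : ℂ} (hc : c ∈ P.centers) (hc' : c' ∈ P.centers)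
    (hz : z ∈ Metric.closedBall c (P.radius c)) (hz' : z ∈ Metric.closedBall c' (P.radius c')) :
    c = c' := by
  by_contra hne
  exact Set.disjoint_left.1
    (Metric.closedBall_disjoint_closedBall (P.disjoint c hc c' hc' hne)) hz hz'

theorem sum_eq_of_mem_closedBall {f : ℂ → ℂ} {c z : ℂ} (hc : c ∈ P.centers)
    (hz : z ∈ Metric.closedBall c (P.radius c))
    (h : ∀ c' ∈ P.centers, z ∉ Metric.closedBall c' (P.radius c') → f c' = 0) :
    ∑ c' ∈ P.centers, f c' = f c :=
  Finset.sum_eq_single_of_mem c hc fun c' hc' hne =>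
    h c' hc' fun hz' => hne (P.eq_of_mem_closedBall hc' hc hz' hz)

theorem ofReal_pi_mul_sum_sq {s : Finset ℂ} (hs : s ⊆ P.centers) :
    ENNReal.ofReal (Real.pi * ∑ c ∈ s, P.radius c ^ 2) =
      volume (⋃ c ∈ s, Metric.closedBall c (P.radius c)) := by
  rw [measure_biUnion_finset]
  · rw [Finset.mul_sum, ENNReal.ofReal_sum_of_nonneg fun c _ => by positivity]
    refine Finset.sum_congr rfl fun c hc => ?_
    rw [volume_closedBall_complex c (P.radius_pos c (hs hc)).le]
  · intro c hc c' hc' hne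
    exact Metric.closedBall_disjoint_closedBall (P.disjoint c (hs hc) c' (hs hc') hne)
  · exact fun c _ => Metric.isClosed_closedBall.measurableSet

theorem sum_sq_le_of_subset {s : Finset ℂ} (hs : s ⊆ P.centers) {x : ℂ} {ρ : ℝ} (hρ : 0 ≤ ρ)
    (h : ∀ c ∈ s, Metric.closedBall c (P.radius c) ⊆ Metric.closedBall x ρ) :
    ∑ c ∈ s, P.radius c ^ 2 ≤ ρ ^ 2 := by
  have hvol : ENNReal.ofReal (Real.pi * ∑ c ∈ s, P.radius c ^ 2)
      ≤ ENNReal.ofReal (Real.pi * ρ ^ 2) := by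
    rw [P.ofReal_pi_mul_sum_sq hs, ← volume_closedBall_complex x hρ]
    exact measure_mono (Set.iUnion₂_subset h)
  rw [ENNReal.ofReal_le_ofReal_iff (by positivity)] at hvol
  exact le_of_mul_le_mul_left hvol Real.pi_pos

theorem sum_sq_le_one : ∑ c ∈ P.centers, P.radius c ^ 2 ≤ 1 := by
  simpa using P.sum_sq_le_of_subset subset_rfl zero_le_one fun c hc => P.closedBall_subset hc

end DiscPacking

theorem exists_disjoint_closedBall_filling_unit_disc : ∃ (t : Set ℂ) (r : ℂ → ℝ),
    (∀ c ∈ t, 0 < r c ∧ r c ≤ 1 / 2 ∧ ‖c‖ + r c ≤ 1) ∧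
    t.PairwiseDisjoint (fun c => Metric.closedBall c (r c)) ∧
    ENNReal.ofReal Real.pi ≤ ∑' c : t, ENNReal.ofReal (Real.pi * r c ^ 2) := by
  obtain ⟨t, r, ht, -, hr, hvol, hdisj⟩ := Besicovitch.exists_disjoint_closedBall_covering_ae
    (volume : Measure ℂ) (fun _ => Set.univ) (Metric.ball 0 1)
    (fun x _ δ hδ => by simpa using hδ) (fun x => min (1 / 2) (1 - ‖x‖))
    (fun x hx => by simpa using hx)
  refine ⟨t, r, fun c hc => ⟨(hr c hc).2.1, ?_, ?_⟩, hdisj, ?_⟩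
  · exact ((hr c hc).2.2.trans_le (min_le_left _ _)).le
  · linarith [(hr c hc).2.2.trans_le (min_le_right _ _)]
  · calc ENNReal.ofReal Real.pi
        = volume (Metric.ball (0 : ℂ) 1) := by
          rw [← Measure.addHaar_closedBall_eq_addHaar_ball, volume_closedBall_complex 0 zero_le_one,
            one_pow, mul_one]
      _ ≤ volume (⋃ c ∈ t, Metric.closedBall c (r c)) :=
          measure_mono_ae (ae_le_set.2 hvol)
      _ = ∑' c : t, volume (Metric.closedBall (c : ℂ) (r c)) :=
          measure_biUnion ht hdisj fun c _ => Metric.isClosed_closedBall.measurableSet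
      _ = ∑' c : t, ENNReal.ofReal (Real.pi * r c ^ 2) :=
          tsum_congr fun c => volume_closedBall_complex _ (hr c c.2).2.1.le

theorem exists_discPacking {a : ℝ} (ha : a < 1) :
    ∃ P : DiscPacking, a < ∑ c ∈ P.centers, P.radius c ^ 2 := by
  obtain ⟨t, r, hr, hdisj, hvol⟩ := exists_disjoint_closedBall_filling_unit_disc
  have hlt : ENNReal.ofReal (Real.pi * a) < ENNReal.ofReal Real.pi := by
    rw [ENNReal.ofReal_lt_ofReal_iff Real.pi_pos]
    exact mul_lt_of_lt_one_right Real.pi_pos ha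
  obtain ⟨s, hs⟩ := lt_iSup_iff.1 ((hlt.trans_le hvol).trans_eq ENNReal.tsum_eq_iSup_sum)
  have hmem : ∀ c ∈ s.map (Function.Embedding.subtype _), c ∈ t := fun c hc => by
    obtain ⟨y, -, rfl⟩ := Finset.mem_map.1 hc
    exact y.2
  refine ⟨{ centers := s.map (Function.Embedding.subtype _)
            radius := r
            radius_pos := fun c hc => (hr c (hmem c hc)).1
            radius_le := fun c hc => (hr c (hmem c hc)).2.1
            disjoint := fun c hc c' hc' hne =>
              (disjoint_closedBall_closedBall_iff (hr c (hmem c hc)).1.le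
                (hr c' (hmem c' hc')).1.le).1 (hdisj (hmem c hc) (hmem c' hc') hne)
            norm_add_radius_le := fun c hc => (hr c (hmem c hc)).2.2 }, ?_⟩
  rw [← ENNReal.ofReal_sum_of_nonneg fun c _ => by positivity, ← Finset.mul_sum] at hs
  rw [Finset.sum_map]
  exact lt_of_mul_lt_mul_left (lt_of_not_ge fun h => hs.not_ge (ENNReal.ofReal_le_ofReal h))
    Real.pi_pos.le

/-- The similarity taking the closed disc of centre `c` and radius `ρ` to the unit disc. -/
noncomputable def zoom (c : ℂ) (ρ : ℝ) (x : ℂ) : ℂ := ρ⁻¹ • (x - c)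

theorem norm_zoom {c x : ℂ} {ρ : ℝ} (hρ : 0 < ρ) : ‖zoom c ρ x‖ = ‖x - c‖ / ρ := by
  rw [zoom, norm_smul, norm_inv, Real.norm_of_nonneg hρ.le, inv_mul_eq_div]

theorem zoom_mem_closedBall_iff {c x : ℂ} {ρ : ℝ} (hρ : 0 < ρ) :
    zoom c ρ x ∈ Metric.closedBall 0 1 ↔ x ∈ Metric.closedBall c ρ := by
  rw [mem_closedBall_zero_iff, mem_closedBall_iff_norm, norm_zoom hρ, div_le_one hρ]

theorem smul_zoom {c x : ℂ} {ρ : ℝ} (hρ : ρ ≠ 0) : ρ • zoom c ρ x = x - c := by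
  rw [zoom, smul_inv_smul₀ hρ]

theorem zoom_add_smul {c x : ℂ} {ρ : ℝ} (hρ : ρ ≠ 0) : zoom c ρ (c + ρ • x) = x := by
  rw [zoom, add_sub_cancel_left, inv_smul_smul₀ hρ]

theorem inv_smul_zoom (c x : ℂ) (a ρ : ℝ) : a⁻¹ • zoom c ρ x = zoom c (ρ * a) x := by
  rw [zoom, zoom, smul_smul, mul_inv, mul_comm]

@[fun_prop]
theorem continuous_zoom (c : ℂ) (ρ : ℝ) : Continuous (zoom c ρ) := by
  unfold zoom; fun_prop

theorem volume_zoom_preimage (c : ℂ) {ρ : ℝ} (hρ : 0 < ρ) (A : Set ℂ) :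
    volume (zoom c ρ ⁻¹' A) = ENNReal.ofReal (ρ ^ 2) * volume A := by
  have : zoom c ρ ⁻¹' A = (fun x => x + -c) ⁻¹' ((ρ⁻¹ • ·) ⁻¹' A) := by
    ext x; simp only [Set.mem_preimage, zoom, sub_eq_add_neg]
  rw [this, measure_preimage_add_right, Measure.addHaar_preimage_smul _ (inv_ne_zero hρ.ne'),
    Complex.finrank_real_complex, inv_pow, inv_inv, abs_of_pos (by positivity)]

namespace DiscPacking

variable (P : DiscPacking)

theorem radius_rpow_pos {c : ℂ} (hc : c ∈ P.centers) (p : ℝ) : 0 < P.radius c ^ p :=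
  Real.rpow_pos_of_pos (P.radius_pos c hc) p

theorem radius_rpow_eq {c : ℂ} (hc : c ∈ P.centers) (p : ℝ) :
    P.radius c ^ p = P.radius c * P.radius c ^ (p - 1) := by
  rw [Real.rpow_sub_one (P.radius_pos c hc).ne', mul_div_cancel₀ _ (P.radius_pos c hc).ne']

theorem radius_rpow_le {c : ℂ} (hc : c ∈ P.centers) {p : ℝ} (hp : 1 ≤ p) :
    P.radius c ^ p ≤ P.radius c * (1 / 2) ^ (p - 1) := by
  rw [P.radius_rpow_eq hc]
  exact mul_le_mul_of_nonneg_left (Real.rpow_le_rpow (P.radius_pos c hc).le (P.radius_le c hc)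
    (sub_nonneg.2 hp)) (P.radius_pos c hc).le

theorem radius_rpow_le_radius {c : ℂ} (hc : c ∈ P.centers) {p : ℝ} (hp : 1 ≤ p) :
    P.radius c ^ p ≤ P.radius c :=
  (P.radius_rpow_le hc hp).trans (mul_le_of_le_one_right (P.radius_pos c hc).le
    (Real.rpow_le_one (by norm_num) (by norm_num) (sub_nonneg.2 hp)))

theorem mem_closedBall_of_zoom_rpow_mem {c z : ℂ} (hc : c ∈ P.centers) {p : ℝ} (hp : 1 ≤ p)
    (hz : zoom c (P.radius c ^ p) z ∈ Metric.closedBall 0 1) :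
    z ∈ Metric.closedBall c (P.radius c) :=
  Metric.closedBall_subset_closedBall (P.radius_rpow_le_radius hc hp)
    ((zoom_mem_closedBall_iff (P.radius_rpow_pos hc p)).1 hz)

end DiscPacking

/-- The `m`-th approximation of the Cantor set built from the packings `P n, P (n + 1), …`, where a
disc `B(c, r)` of a packing is replaced by its concentric disc of radius `r ^ p`. -/
noncomputable def levelSet (P : ℕ → DiscPacking) (p : ℝ) : ℕ → ℕ → Set ℂ
  | 0, _ => Metric.closedBall 0 1
  | m + 1, n => ⋃ c ∈ (P n).centers, zoom c ((P n).radius c ^ p) ⁻¹' levelSet P p m (n + 1)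

/-- The Cantor set built from the packings `P n, P (n + 1), …` with exponent `p`. -/
noncomputable def limitSet (P : ℕ → DiscPacking) (p : ℝ) (n : ℕ) : Set ℂ := ⋂ m, levelSet P p m n

section LevelSets

variable {P : ℕ → DiscPacking} {p : ℝ}

theorem mem_levelSet_succ {m n : ℕ} {z : ℂ} : z ∈ levelSet P p (m + 1) n ↔
    ∃ c ∈ (P n).centers, zoom c ((P n).radius c ^ p) z ∈ levelSet P p m (n + 1) := by
  simp [levelSet]

theorem levelSet_subset_closedBall (hp : 1 ≤ p) (m n : ℕ) :
    levelSet P p m n ⊆ Metric.closedBall 0 1 := by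
  induction m generalizing n with
  | zero => exact subset_rfl
  | succ m ih =>
    intro z hz
    obtain ⟨c, hc, h⟩ := mem_levelSet_succ.1 hz
    exact (P n).closedBall_subset hc ((P n).mem_closedBall_of_zoom_rpow_mem hc hp (ih _ h))

theorem antitone_levelSet (hp : 1 ≤ p) (n : ℕ) : Antitone fun m => levelSet P p m n := by
  refine antitone_nat_of_succ_le fun m => ?_
  induction m generalizing n with
  | zero => exact levelSet_subset_closedBall hp 1 n
  | succ m ih =>
    intro z hz
    obtain ⟨c, hc, h⟩ := mem_levelSet_succ.1 hz
    exact mem_levelSet_succ.2 ⟨c, hc, ih _ h⟩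

theorem isClosed_levelSet (m n : ℕ) : IsClosed (levelSet P p m n) := by
  induction m generalizing n with
  | zero => exact Metric.isClosed_closedBall
  | succ m ih =>
    exact isClosed_biUnion_finset fun c _ => (ih (n + 1)).preimage (continuous_zoom _ _)

theorem limitSet_subset_levelSet (m n : ℕ) : limitSet P p n ⊆ levelSet P p m n :=
  Set.iInter_subset _ m

theorem isCompact_limitSet (n : ℕ) : IsCompact (limitSet P p n) :=
  (isCompact_closedBall (0 : ℂ) 1).of_isClosed_subset
    (isClosed_iInter fun m => isClosed_levelSet m n) (limitSet_subset_levelSet 0 n)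

theorem zoom_mem_levelSet_of_mem_closedBall (hp : 1 ≤ p) {m n : ℕ} {c z : ℂ}
    (hc : c ∈ (P n).centers) (hz : z ∈ Metric.closedBall c ((P n).radius c))
    (h : z ∈ levelSet P p (m + 1) n) :
    zoom c ((P n).radius c ^ p) z ∈ levelSet P p m (n + 1) := by
  obtain ⟨c', hc', h'⟩ := mem_levelSet_succ.1 h
  have hz' := (P n).mem_closedBall_of_zoom_rpow_mem hc' hp (levelSet_subset_closedBall hp _ _ h')
  rwa [(P n).eq_of_mem_closedBall hc hc' hz hz']

theorem exists_zoom_mem_limitSet (hp : 1 ≤ p) {n : ℕ} {z : ℂ} (hz : z ∈ limitSet P p n) :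
    ∃ c ∈ (P n).centers, zoom c ((P n).radius c ^ p) z ∈ limitSet P p (n + 1) := by
  obtain ⟨c, hc, h⟩ := mem_levelSet_succ.1 (limitSet_subset_levelSet 1 n hz)
  exact ⟨c, hc, Set.mem_iInter.2 fun m => zoom_mem_levelSet_of_mem_closedBall hp hc
    ((P n).mem_closedBall_of_zoom_rpow_mem hc hp h) (limitSet_subset_levelSet (m + 1) n hz)⟩

theorem volume_levelSet_le (hp : 1 ≤ p) (m n : ℕ) :
    volume (levelSet P p m n) ≤ ENNReal.ofReal (Real.pi * (((1 / 2) ^ (p - 1)) ^ 2) ^ m) := by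
  induction m generalizing n with
  | zero => simpa [levelSet] using (volume_closedBall_complex 0 zero_le_one).le
  | succ m ih =>
    set κ : ℝ := ((1 / 2) ^ (p - 1)) ^ 2 with hκ
    calc volume (levelSet P p (m + 1) n)
        ≤ ∑ c ∈ (P n).centers, volume (zoom c ((P n).radius c ^ p) ⁻¹' levelSet P p m (n + 1)) :=
          measure_biUnion_finset_le _ _
      _ ≤ ∑ c ∈ (P n).centers, ENNReal.ofReal ((P n).radius c ^ 2 * κ * (Real.pi * κ ^ m)) := by
          refine Finset.sum_le_sum fun c hc => ?_
          rw [volume_zoom_preimage c ((P n).radius_rpow_pos hc p),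
            ENNReal.ofReal_mul (by positivity)]
          refine mul_le_mul' (ENNReal.ofReal_le_ofReal ?_) (ih _)
          rw [hκ, ← mul_pow]
          exact pow_le_pow_left₀ ((P n).radius_rpow_pos hc p).le ((P n).radius_rpow_le hc hp) 2
      _ = ENNReal.ofReal ((∑ c ∈ (P n).centers, (P n).radius c ^ 2) * (Real.pi * κ ^ (m + 1))) := by
          rw [← ENNReal.ofReal_sum_of_nonneg fun c _ => by positivity, Finset.sum_mul]
          exact congrArg _ (Finset.sum_congr rfl fun c _ => by ring)
      _ ≤ _ := ENNReal.ofReal_le_ofReal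
          (mul_le_of_le_one_left (by positivity) (P n).sum_sq_le_one)

theorem volume_levelSet_one_succ (m n : ℕ) :
    volume (levelSet P 1 (m + 1) n) =
      ENNReal.ofReal (∑ c ∈ (P n).centers, (P n).radius c ^ 2) *
        volume (levelSet P 1 m (n + 1)) := by
  have hsum : volume (levelSet P 1 (m + 1) n) = ∑ c ∈ (P n).centers,
      volume (zoom c ((P n).radius c ^ (1 : ℝ)) ⁻¹' levelSet P 1 m (n + 1)) := by
    refine measure_biUnion_finset ?_ fun c _ =>
      ((isClosed_levelSet m (n + 1)).preimage (continuous_zoom _ _)).measurableSet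
    intro c hc c' hc' hne
    refine Set.disjoint_left.2 fun z hz hz' => hne ?_
    exact (P n).eq_of_mem_closedBall hc hc'
      ((P n).mem_closedBall_of_zoom_rpow_mem hc le_rfl (levelSet_subset_closedBall le_rfl _ _ hz))
      ((P n).mem_closedBall_of_zoom_rpow_mem hc' le_rfl (levelSet_subset_closedBall le_rfl _ _ hz'))
  rw [hsum, ENNReal.ofReal_sum_of_nonneg fun c _ => by positivity, Finset.sum_mul]
  refine Finset.sum_congr rfl fun c hc => ?_
  rw [volume_zoom_preimage c ((P n).radius_rpow_pos hc 1), Real.rpow_one]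

theorem le_volume_levelSet_one {v : ℕ → ℝ} (hv1 : ∀ n, v n ≤ 1)
    (hv : ∀ n, v n ≤ (∑ c ∈ (P n).centers, (P n).radius c ^ 2) * v (n + 1)) (m n : ℕ) :
    ENNReal.ofReal (Real.pi * v n) ≤ volume (levelSet P 1 m n) := by
  induction m generalizing n with
  | zero =>
    rw [levelSet, volume_closedBall_complex 0 zero_le_one, one_pow]
    exact ENNReal.ofReal_le_ofReal (mul_le_mul_of_nonneg_left (hv1 n) Real.pi_pos.le)
  | succ m ih =>
    rw [volume_levelSet_one_succ]
    refine le_trans ?_ (mul_le_mul_right (ih (n + 1)) _)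
    rw [← ENNReal.ofReal_mul (Finset.sum_nonneg fun c _ => by positivity), mul_left_comm]
    exact ENNReal.ofReal_le_ofReal (mul_le_mul_of_nonneg_left (hv n) Real.pi_pos.le)

theorem volume_limitSet_one_pos {v : ℕ → ℝ} (hv1 : ∀ n, v n ≤ 1)
    (hv : ∀ n, v n ≤ (∑ c ∈ (P n).centers, (P n).radius c ^ 2) * v (n + 1)) {n : ℕ}
    (hn : 0 < v n) : 0 < volume (limitSet P 1 n) := by
  have hlim : Tendsto (fun m => volume (levelSet P 1 m n)) atTop (𝓝 (volume (limitSet P 1 n))) :=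
    tendsto_measure_iInter_atTop (fun m => (isClosed_levelSet m n).measurableSet.nullMeasurableSet)
      (antitone_levelSet le_rfl n) ⟨0, (isCompact_closedBall (0 : ℂ) 1).measure_lt_top.ne⟩
  exact (ENNReal.ofReal_pos.2 (mul_pos Real.pi_pos hn)).trans_le
    (ge_of_tendsto' hlim fun m => le_volume_levelSet_one hv1 hv m n)

/-- With `v n = (n + 1) / (n + 2)`, packings of density at least `v n / v (n + 1)` keep the area of
the `m`-th approximations above `π v 0`. -/
theorem exists_volume_limitSet_one_pos :
    ∃ P : ℕ → DiscPacking, 0 < volume (limitSet P 1 0) := by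
  set v : ℕ → ℝ := fun n => (n + 1) / (n + 2) with hv
  have hv0 : ∀ n, 0 < v n := fun n => by positivity
  have hlt : ∀ n, v n / v (n + 1) < 1 := fun n => by
    rw [div_lt_one (hv0 _), hv, div_lt_div_iff₀ (by positivity) (by positivity)]
    push_cast
    linarith
  choose P hP using fun n => exists_discPacking (hlt n)
  refine ⟨P, volume_limitSet_one_pos (v := v) (fun n => ?_) (fun n => ?_) (hv0 0)⟩
  · rw [hv, div_le_one (by positivity)]
    linarith
  · exact ((div_le_iff₀ (hv0 _)).1 (hP n).le)

end LevelSets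

section Covers

/-- `E` is covered by finitely many balls of radius at most `δ` whose radii have `s`-th powers
adding up to at most `1`. -/
def HasBallCover {X : Type*} [MetricSpace X] (s δ : ℝ) (E : Set X) : Prop :=
  ∃ (ι : Type) (_ : Fintype ι) (b : ι → X) (ρ : ι → ℝ), (∀ i, 0 ≤ ρ i) ∧ (∀ i, ρ i ≤ δ) ∧
    E ⊆ ⋃ i, Metric.closedBall (b i) (ρ i) ∧ ∑ i, ρ i ^ s ≤ 1

theorem hausdorffMeasure_lt_top_of_hasBallCover {X : Type*} [MetricSpace X] [MeasurableSpace X]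
    [BorelSpace X] {s : ℝ} (hs : 0 ≤ s) {E : Set X} {δ : ℕ → ℝ} (hδ : Tendsto δ atTop (𝓝 0))
    (hE : ∀ m, HasBallCover s (δ m) E) : Measure.hausdorffMeasure s E < ⊤ := by
  choose ι hι b ρ h0 hle hcov hsum using hE
  have hdiam : ∀ m i, Metric.ediam (Metric.closedBall (b m i) (ρ m i)) ≤
      ENNReal.ofReal (2 * ρ m i) := fun m i => by
    rw [ENNReal.ofReal_mul zero_le_two, ENNReal.ofReal_ofNat, ← Metric.closedEBall_ofReal (h0 m i)]
    exact Metric.ediam_closedEBall_le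
  have hbound : ∀ m, ∑ i, Metric.ediam (Metric.closedBall (b m i) (ρ m i)) ^ s ≤
      ENNReal.ofReal (2 ^ s) := fun m => by
    calc ∑ i, Metric.ediam (Metric.closedBall (b m i) (ρ m i)) ^ s
        ≤ ∑ i, ENNReal.ofReal (2 ^ s * ρ m i ^ s) := by
          refine Finset.sum_le_sum fun i _ => (ENNReal.rpow_le_rpow (hdiam m i) hs).trans_eq ?_
          rw [ENNReal.ofReal_rpow_of_nonneg (mul_nonneg zero_le_two (h0 m i)) hs,
            Real.mul_rpow zero_le_two (h0 m i)]
      _ = ENNReal.ofReal (2 ^ s * ∑ i, ρ m i ^ s) := by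
          rw [Finset.mul_sum, ENNReal.ofReal_sum_of_nonneg fun i _ =>
            mul_nonneg (by positivity) (Real.rpow_nonneg (h0 m i) _)]
      _ ≤ _ := ENNReal.ofReal_le_ofReal (mul_le_of_le_one_right (by positivity) (hsum m))
  have hsmall : Tendsto (fun m => ENNReal.ofReal (2 * δ m)) atTop (𝓝 0) := by
    simpa using ENNReal.tendsto_ofReal (hδ.const_mul 2)
  refine (Measure.hausdorffMeasure_le_liminf_sum s E (l := atTop) _ hsmall
    (fun m i => Metric.closedBall (b m i) (ρ m i))
    (Eventually.of_forall fun m i => (hdiam m i).trans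
      (ENNReal.ofReal_le_ofReal (by linarith [hle m i])))
    (Eventually.of_forall hcov)).trans_lt ?_
  refine lt_of_le_of_lt ?_ (ENNReal.ofReal_lt_top (r := 2 ^ s))
  exact liminf_le_of_frequently_le (Frequently.of_forall hbound)

theorem HasBallCover.mono {X : Type*} [MetricSpace X] {s δ : ℝ} {E F : Set X}
    (hF : HasBallCover s δ F) (h : E ⊆ F) : HasBallCover s δ E := by
  obtain ⟨ι, _, b, ρ, h0, hle, hcov, hsum⟩ := hF
  exact ⟨ι, inferInstance, b, ρ, h0, hle, h.trans hcov, hsum⟩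

theorem zoom_preimage_closedBall {ρ : ℝ} (hρ : 0 < ρ) (c b : ℂ) (σ : ℝ) :
    zoom c ρ ⁻¹' Metric.closedBall b σ = Metric.closedBall (c + ρ • b) (ρ * σ) := by
  ext z
  have hz : z - (c + ρ • b) = ρ • (zoom c ρ z - b) := by
    rw [smul_sub, smul_zoom hρ.ne', sub_sub]
  rw [Set.mem_preimage, mem_closedBall_iff_norm, mem_closedBall_iff_norm, hz, norm_smul,
    Real.norm_of_nonneg hρ.le, mul_le_mul_iff_right₀ hρ]

theorem HasBallCover.iUnion_zoom_preimage (P : DiscPacking) {p : ℝ} (hp : 1 ≤ p) {δ : ℝ}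
    {F : Set ℂ} (hF : HasBallCover (2 / p) δ F) : HasBallCover (2 / p) (1 / 2 * δ)
      (⋃ c ∈ P.centers, zoom c (P.radius c ^ p) ⁻¹' F) := by
  obtain ⟨ι, _, b, ρ, h0, hle, hcov, hsum⟩ := hF
  refine ⟨P.centers × ι, inferInstance, fun i => i.1 + (P.radius i.1 ^ p) • b i.2,
    fun i => P.radius i.1 ^ p * ρ i.2,
    fun i => mul_nonneg (P.radius_rpow_pos i.1.2 p).le (h0 _), fun i => ?_, ?_, ?_⟩
  · exact mul_le_mul ((P.radius_rpow_le_radius i.1.2 hp).trans (P.radius_le _ i.1.2)) (hle _)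
      (h0 _) (by norm_num)
  · refine Set.iUnion₂_subset fun c hc z hz => ?_
    obtain ⟨i, hi⟩ := Set.mem_iUnion.1 (hcov hz)
    rw [← Set.mem_preimage, zoom_preimage_closedBall (P.radius_rpow_pos hc p)] at hi
    exact Set.mem_iUnion.2 ⟨(⟨c, hc⟩, i), hi⟩
  · have hrow : ∀ c : P.centers, ∑ i, (P.radius c ^ p * ρ i) ^ (2 / p) =
        P.radius c ^ 2 * ∑ i, ρ i ^ (2 / p) := fun c => by
      rw [Finset.mul_sum]
      refine Finset.sum_congr rfl fun i _ => ?_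
      rw [Real.mul_rpow (P.radius_rpow_pos c.2 p).le (h0 _),
        ← Real.rpow_mul (P.radius_pos c c.2).le, mul_div_cancel₀ _ (by linarith), Real.rpow_two]
    rw [Fintype.sum_prod_type]
    simp only [hrow]
    rw [← Finset.sum_mul, Finset.sum_coe_sort P.centers fun c => P.radius c ^ 2]
    exact mul_le_one₀ P.sum_sq_le_one (Finset.sum_nonneg fun i _ => Real.rpow_nonneg (h0 i) _) hsum

variable {P : ℕ → DiscPacking} {p : ℝ}

theorem hasBallCover_levelSet (hp : 1 ≤ p) (m n : ℕ) :
    HasBallCover (2 / p) ((1 / 2) ^ m) (levelSet P p m n) := by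
  induction m generalizing n with
  | zero =>
    refine ⟨Unit, inferInstance, fun _ => 0, fun _ => 1, by simp, by simp, ?_, by simp⟩
    exact Set.subset_iUnion (fun _ : Unit => Metric.closedBall (0 : ℂ) 1) ()
  | succ m ih =>
    rw [pow_succ']
    exact (ih (n + 1)).iUnion_zoom_preimage (P n) hp

theorem hausdorffMeasure_limitSet_lt_top (hp : 1 ≤ p) (n : ℕ) :
    Measure.hausdorffMeasure (2 / p) (limitSet P p n) < ⊤ :=
  hausdorffMeasure_lt_top_of_hasBallCover (by positivity)
    (tendsto_pow_atTop_nhds_zero_of_lt_one (by norm_num) (by norm_num)) fun m =>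
    (hasBallCover_levelSet hp m n).mono (limitSet_subset_levelSet m n)

end Covers

/-- A self-map of the plane preserving the closed unit disc and equal to the identity outside. -/
structure IsDiscMap (g : ℂ → ℂ) : Prop where
  eq_self : ∀ z, 1 < ‖z‖ → g z = z
  norm_le_one : ∀ z, ‖z‖ ≤ 1 → ‖g z‖ ≤ 1

namespace IsDiscMap

theorem id : IsDiscMap id := ⟨fun _ _ => rfl, fun _ => _root_.id⟩

theorem norm_sub_le_two {g g' : ℂ → ℂ} (hg : IsDiscMap g) (hg' : IsDiscMap g') (z : ℂ) :
    ‖g z - g' z‖ ≤ 2 := by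
  rcases lt_or_ge 1 ‖z‖ with hz | hz
  · rw [hg.eq_self z hz, hg'.eq_self z hz, sub_self, norm_zero]
    exact zero_le_two
  · linarith [norm_sub_le (g z) (g' z), hg.norm_le_one z hz, hg'.norm_le_one z hz]

theorem of_tendsto {G : ℕ → ℂ → ℂ} {g : ℂ → ℂ} (hG : ∀ m, IsDiscMap (G m))
    (h : ∀ z, Tendsto (fun m => G m z) atTop (𝓝 (g z))) : IsDiscMap g where
  eq_self z hz := tendsto_nhds_unique (h z) (by
    simp only [(hG _).eq_self z hz]
    exact tendsto_const_nhds)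
  norm_le_one z hz := le_of_tendsto' (h z).norm fun m => (hG m).norm_le_one z hz

end IsDiscMap

section DiscStretch

/-- The radial stretching of the annulus `a ≤ |w| ≤ 1` onto `b ≤ |w| ≤ 1`, with a rescaled copy
of `g` from the disc `|w| ≤ a` to `|w| ≤ b`. For `a = 1` only the copy of `g` matters, and the
exponent `Real.logb 1 b = 0` is never used inside the unit disc. -/
noncomputable def discStretch (a b : ℝ) (g : ℂ → ℂ) (w : ℂ) : ℂ :=
  if ‖w‖ ≤ a then b • g (a⁻¹ • w) else (min ‖w‖ 1) ^ (Real.logb a b - 1) • w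

variable {a b : ℝ} {g : ℂ → ℂ}

theorem discStretch_of_norm_le {w : ℂ} (hw : ‖w‖ ≤ a) : discStretch a b g w = b • g (a⁻¹ • w) :=
  if_pos hw

theorem discStretch_of_mem_annulus {w : ℂ} (hw : a < ‖w‖) (hw1 : ‖w‖ ≤ 1) :
    discStretch a b g w = ‖w‖ ^ (Real.logb a b - 1) • w := by
  rw [discStretch, if_neg hw.not_ge, min_eq_left hw1]

theorem discStretch_congr {g' : ℂ → ℂ} {w : ℂ} (h : g (a⁻¹ • w) = g' (a⁻¹ • w)) :
    discStretch a b g w = discStretch a b g' w := by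
  rw [discStretch, discStretch, h]

theorem norm_discStretch_of_mem_annulus (ha : 0 < a) {w : ℂ} (hw : a < ‖w‖) (hw1 : ‖w‖ ≤ 1) :
    ‖discStretch a b g w‖ = ‖w‖ ^ Real.logb a b := by
  have hw0 : 0 < ‖w‖ := ha.trans hw
  rw [discStretch_of_mem_annulus hw hw1, norm_smul, Real.norm_of_nonneg (by positivity),
    ← Real.rpow_add_one hw0.ne', sub_add_cancel]

theorem norm_inv_smul_le_one (ha : 0 < a) {w : ℂ} (hw : ‖w‖ ≤ a) : ‖a⁻¹ • w‖ ≤ 1 := by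
  rwa [norm_smul, norm_inv, Real.norm_of_nonneg ha.le, inv_mul_le_one₀ ha]

theorem norm_discStretch_le (ha : 0 < a) (hb : 0 < b) (hg : IsDiscMap g) {w : ℂ}
    (hw : ‖w‖ ≤ a) : ‖discStretch a b g w‖ ≤ b := by
  rw [discStretch_of_norm_le hw, norm_smul, Real.norm_of_nonneg hb.le]
  exact mul_le_of_le_one_right hb.le (hg.norm_le_one _ (norm_inv_smul_le_one ha hw))

theorem logb_nonneg_of_le_one (ha : 0 < a) (ha1 : a ≤ 1) (hb : 0 < b) (hb1 : b ≤ 1) :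
    0 ≤ Real.logb a b :=
  div_nonneg_of_nonpos (Real.log_nonpos hb.le hb1) (Real.log_nonpos ha.le ha1)

theorem isDiscMap_discStretch (ha : 0 < a) (ha1 : a ≤ 1) (hb : 0 < b) (hb1 : b ≤ 1)
    (hg : IsDiscMap g) : IsDiscMap (discStretch a b g) where
  eq_self w hw := by
    rw [discStretch, if_neg (ha1.trans_lt hw).not_ge, min_eq_right hw.le, Real.one_rpow, one_smul]
  norm_le_one w hw := by
    rcases le_or_gt ‖w‖ a with h | h
    · exact (norm_discStretch_le ha hb hg h).trans hb1
    · rw [norm_discStretch_of_mem_annulus ha h hw]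
      exact Real.rpow_le_one (norm_nonneg _) hw (logb_nonneg_of_le_one ha ha1 hb hb1)

theorem discStretch_discStretch (ha : 0 < a) (ha1 : a < 1) (hb : 0 < b) (hb1 : b < 1)
    (hg : IsDiscMap g) {h : ℂ → ℂ} (hh : IsDiscMap h) (hhg : ∀ z, h (g z) = z) (w : ℂ) :
    discStretch b a h (discStretch a b g w) = w := by
  rcases le_or_gt ‖w‖ a with hwa | hwa
  · rw [discStretch_of_norm_le (norm_discStretch_le ha hb hg hwa), discStretch_of_norm_le hwa,
      inv_smul_smul₀ hb.ne', hhg, smul_inv_smul₀ ha.ne']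
  rcases lt_or_ge 1 ‖w‖ with hw1 | hw1
  · rw [(isDiscMap_discStretch ha ha1.le hb hb1.le hg).eq_self w hw1,
      (isDiscMap_discStretch hb hb1.le ha ha1.le hh).eq_self w hw1]
  have hw0 : 0 < ‖w‖ := ha.trans hwa
  have hκ : 0 < Real.logb a b := div_pos_of_neg_of_neg (Real.log_neg hb hb1) (Real.log_neg ha ha1)
  have hnorm := norm_discStretch_of_mem_annulus (b := b) (g := g) ha hwa hw1
  have hinner : b < ‖discStretch a b g w‖ := by
    calc b = a ^ Real.logb a b := (Real.rpow_logb ha ha1.ne hb).symm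
      _ < ‖discStretch a b g w‖ := hnorm ▸ Real.rpow_lt_rpow ha.le hwa hκ
  have houter : ‖discStretch a b g w‖ ≤ 1 := hnorm ▸ Real.rpow_le_one hw0.le hw1 hκ.le
  rw [discStretch_of_mem_annulus hinner houter, hnorm, discStretch_of_mem_annulus hwa hw1,
    smul_smul, ← Real.rpow_mul hw0.le, ← Real.rpow_add hw0, ← Real.inv_logb a b, mul_sub,
    mul_inv_cancel₀ hκ.ne', mul_one, sub_add_sub_cancel, sub_self, Real.rpow_zero, one_smul]

theorem measurable_discStretch (hg : Measurable g) : Measurable (discStretch a b g) := by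
  refine Measurable.ite (measurableSet_le measurable_norm measurable_const) ?_ (by fun_prop)
  exact (hg.comp (measurable_const_smul _)).const_smul b

theorem tendsto_discStretch {G : ℕ → ℂ → ℂ} (h : ∀ z, Tendsto (fun m => G m z) atTop (𝓝 (g z)))
    (w : ℂ) : Tendsto (fun m => discStretch a b (G m) w) atTop (𝓝 (discStretch a b g w)) := by
  unfold discStretch
  split_ifs
  · exact (h _).const_smul b
  · exact tendsto_const_nhds

theorem norm_discStretch_sub_le (hb : 0 ≤ b) (hb1 : b ≤ 1) {g' : ℂ → ℂ} {C : ℝ}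
    (h : ∀ z, ‖g z - g' z‖ ≤ C) (w : ℂ) :
    ‖discStretch a b g w - discStretch a b g' w‖ ≤ C := by
  have hC : 0 ≤ C := (norm_nonneg _).trans (h 0)
  unfold discStretch
  split_ifs
  · rw [← smul_sub, norm_smul, Real.norm_of_nonneg hb]
    exact (mul_le_of_le_one_left (norm_nonneg _) hb1).trans (h _)
  · rwa [sub_self, norm_zero]

theorem exists_lipschitzWith_norm_smul {E : Type*} [NormedAddCommGroup E] [NormedSpace ℝ E]
    {f : ℝ → ℝ} {L : ℝ≥0} (hf : LipschitzWith L f) (hconst : ∀ t, 1 ≤ t → f t = f 1) :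
    ∃ C : ℝ≥0, LipschitzWith C fun w : E => f ‖w‖ • w := by
  have hbound : ∀ t, 0 ≤ t → |f t| ≤ |f 1| + L := fun t ht => by
    rcases le_total 1 t with h1 | h1
    · rw [hconst t h1]
      exact le_add_of_nonneg_right L.2
    · have hdist := hf.dist_le_mul t 1
      rw [Real.dist_eq, Real.dist_eq, abs_sub_comm t, abs_of_nonneg (sub_nonneg.2 h1)] at hdist
      have hL : (L : ℝ) * (1 - t) ≤ L := mul_le_of_le_one_right L.2 (by linarith)
      linarith [abs_sub_abs_le_abs_sub (f t) (f 1)]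
  have hsmall : ∀ w w' : E, ‖w'‖ ≤ ‖w‖ →
      ‖(f ‖w‖ - f ‖w'‖) • w'‖ ≤ L * ‖w - w'‖ := fun w w' h => by
    rcases le_total 1 ‖w'‖ with h1 | h1
    · rw [hconst _ h1, hconst _ (h1.trans h), sub_self, zero_smul, norm_zero]
      positivity
    · rw [norm_smul, ← dist_eq_norm]
      refine (mul_le_of_le_one_right dist_nonneg h1).trans ((hf.dist_le_mul _ _).trans ?_)
      exact mul_le_mul_of_nonneg_left (abs_norm_sub_norm_le _ _) L.2
  have hle : ∀ w w' : E, ‖w'‖ ≤ ‖w‖ →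
      dist (f ‖w‖ • w) (f ‖w'‖ • w') ≤ (‖f 1‖₊ + L + L : ℝ≥0) * dist w w' := fun w w' h => by
    calc dist (f ‖w‖ • w) (f ‖w'‖ • w')
        = ‖f ‖w‖ • (w - w') + (f ‖w‖ - f ‖w'‖) • w'‖ := by rw [dist_eq_norm]; congr 1; module
      _ ≤ (|f 1| + L) * ‖w - w'‖ + L * ‖w - w'‖ := by
          refine (norm_add_le _ _).trans (add_le_add ?_ (hsmall w w' h))
          rw [norm_smul]
          exact mul_le_mul_of_nonneg_right (hbound _ (norm_nonneg _)) (norm_nonneg _)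
      _ = _ := by rw [dist_eq_norm]; push_cast; rw [Real.norm_eq_abs]; ring
  refine ⟨‖f 1‖₊ + L + L, LipschitzWith.of_dist_le_mul fun w w' => ?_⟩
  rcases le_total ‖w'‖ ‖w‖ with h | h
  · exact hle w w' h
  · rw [dist_comm, dist_comm w]
    exact hle w' w h

theorem exists_lipschitzWith_clamp_rpow (ha : 0 < a) (ha1 : a ≤ 1) (β : ℝ) :
    ∃ L : ℝ≥0, LipschitzWith L fun t : ℝ => (min (max t a) 1) ^ β := by
  obtain ⟨L, hL⟩ : ∃ L : ℝ≥0, LipschitzOnWith L (fun t : ℝ => t ^ β) (Set.Icc a 1) := by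
    refine ContDiffOn.exists_lipschitzOnWith (n := 1) ?_ one_ne_zero (convex_Icc a 1) isCompact_Icc
    exact fun t ht => (Real.contDiffAt_rpow_const_of_ne (ha.trans_le ht.1).ne').contDiffWithinAt
  have hclamp : LipschitzWith 1 fun t : ℝ => min (max t a) 1 :=
    (LipschitzWith.id.max_const a).min_const 1
  exact ⟨L * 1, lipschitzOnWith_univ.1 (hL.comp hclamp.lipschitzOnWith fun t _ =>
    ⟨le_min (le_max_right _ _) ha1, min_le_right _ _⟩)⟩

theorem discStretch_eq_add (ha : 0 < a) (ha1 : a < 1) (hb : 0 < b) (hg : IsDiscMap g) (w : ℂ) :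
    discStretch a b g w =
      (min (max ‖w‖ a) 1) ^ (Real.logb a b - 1) • w + b • (g (a⁻¹ • w) - a⁻¹ • w) := by
  rcases le_or_gt ‖w‖ a with hw | hw
  · rw [discStretch_of_norm_le hw, max_eq_right hw, min_eq_left ha1.le, Real.rpow_sub_one ha.ne',
      Real.rpow_logb ha ha1.ne hb, smul_sub, smul_smul, div_eq_mul_inv]
    ring
  · have hout : 1 < ‖a⁻¹ • w‖ := by
      rwa [norm_smul, norm_inv, Real.norm_of_nonneg ha.le, one_lt_inv_mul₀ ha]
    rw [discStretch, if_neg hw.not_ge, max_eq_left hw.le, hg.eq_self _ hout, sub_self, smul_zero,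
      add_zero]

theorem exists_lipschitzWith_discStretch (ha : 0 < a) (ha1 : a < 1) (hb : 0 < b)
    (hg : IsDiscMap g) (hL : ∃ L, LipschitzWith L g) :
    ∃ L, LipschitzWith L (discStretch a b g) := by
  obtain ⟨L, hL⟩ := hL
  obtain ⟨C, hC⟩ := exists_lipschitzWith_clamp_rpow ha ha1.le (Real.logb a b - 1)
  obtain ⟨D, hD⟩ := exists_lipschitzWith_norm_smul (E := ℂ) hC fun t ht => by
    rw [min_eq_right (le_max_of_le_left ht), min_eq_right (le_max_left _ _)]
  rw [funext (discStretch_eq_add ha ha1 hb hg)]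
  exact ⟨_, hD.add ((lipschitzWith_smul b).comp
    ((hL.comp (lipschitzWith_smul a⁻¹)).sub (lipschitzWith_smul a⁻¹)))⟩

end DiscStretch

namespace DiscPacking

/-- The map that is, on each disc of the packing with centre `c`, a rescaled copy of `f c`, and the
identity elsewhere. The formula is meaningful when all `f c` are disc maps. -/
noncomputable def graft (P : DiscPacking) (f : ℂ → ℂ → ℂ) (z : ℂ) : ℂ :=
  z + ∑ c ∈ P.centers,
    P.radius c • (f c (zoom c (P.radius c) z) - zoom c (P.radius c) z)

variable (P : DiscPacking) {f : ℂ → ℂ → ℂ}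

theorem exists_mem_closedBall_or_forall_notMem (z : ℂ) :
    (∃ c ∈ P.centers, z ∈ Metric.closedBall c (P.radius c)) ∨
      ∀ c ∈ P.centers, z ∉ Metric.closedBall c (P.radius c) := by
  by_contra! h
  obtain ⟨h₁, c, hc, hz⟩ := h
  exact h₁ c hc hz

theorem zoom_eq_self_of_notMem {c z : ℂ} (hc : c ∈ P.centers) (hf : IsDiscMap (f c))
    (hz : z ∉ Metric.closedBall c (P.radius c)) :
    f c (zoom c (P.radius c) z) = zoom c (P.radius c) z := by
  refine hf.eq_self _ ?_
  rwa [← not_le, ← mem_closedBall_zero_iff, zoom_mem_closedBall_iff (P.radius_pos c hc)]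

theorem graft_of_mem (hf : ∀ c ∈ P.centers, IsDiscMap (f c)) {c z : ℂ} (hc : c ∈ P.centers)
    (hz : z ∈ Metric.closedBall c (P.radius c)) :
    P.graft f z = c + P.radius c • f c (zoom c (P.radius c) z) := by
  rw [graft, P.sum_eq_of_mem_closedBall hc hz fun c' hc' hz' => by
    rw [P.zoom_eq_self_of_notMem hc' (hf c' hc') hz', sub_self, smul_zero]]
  rw [smul_sub, smul_zoom (P.radius_pos c hc).ne']
  ring

theorem graft_of_notMem (hf : ∀ c ∈ P.centers, IsDiscMap (f c)) {z : ℂ}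
    (hz : ∀ c ∈ P.centers, z ∉ Metric.closedBall c (P.radius c)) : P.graft f z = z := by
  rw [graft, Finset.sum_eq_zero fun c hc => ?_, add_zero]
  rw [P.zoom_eq_self_of_notMem hc (hf c hc) (hz c hc), sub_self, smul_zero]

theorem graft_mem_closedBall (hf : ∀ c ∈ P.centers, IsDiscMap (f c)) {c z : ℂ}
    (hc : c ∈ P.centers) (hz : z ∈ Metric.closedBall c (P.radius c)) :
    P.graft f z ∈ Metric.closedBall c (P.radius c) := by
  have hr := P.radius_pos c hc
  rw [← zoom_mem_closedBall_iff hr, mem_closedBall_zero_iff] at hz ⊢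
  rw [P.graft_of_mem hf hc ((zoom_mem_closedBall_iff hr).1 (mem_closedBall_zero_iff.2 hz)),
    zoom_add_smul hr.ne']
  exact (hf c hc).norm_le_one _ hz

theorem isDiscMap_graft (hf : ∀ c ∈ P.centers, IsDiscMap (f c)) : IsDiscMap (P.graft f) where
  eq_self z hz := P.graft_of_notMem hf fun c hc hzc =>
    hz.not_ge (mem_closedBall_zero_iff.1 (P.closedBall_subset hc hzc))
  norm_le_one z hz := by
    obtain ⟨c, hc, hzc⟩ | hz' := P.exists_mem_closedBall_or_forall_notMem z
    · exact mem_closedBall_zero_iff.1 (P.closedBall_subset hc (P.graft_mem_closedBall hf hc hzc))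
    · rwa [P.graft_of_notMem hf hz']

theorem graft_graft (hf : ∀ c ∈ P.centers, IsDiscMap (f c)) {h : ℂ → ℂ → ℂ}
    (hh : ∀ c ∈ P.centers, IsDiscMap (h c)) (hhf : ∀ c ∈ P.centers, ∀ w, h c (f c w) = w) (z : ℂ) :
    P.graft h (P.graft f z) = z := by
  obtain ⟨c, hc, hz⟩ | hz := P.exists_mem_closedBall_or_forall_notMem z
  · have hr := (P.radius_pos c hc).ne'
    rw [P.graft_of_mem hh hc (P.graft_mem_closedBall hf hc hz), P.graft_of_mem hf hc hz,
      zoom_add_smul hr, hhf c hc, smul_zoom hr, add_sub_cancel]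
  · rw [P.graft_of_notMem hf hz, P.graft_of_notMem hh hz]

theorem measurable_graft (hf : ∀ c ∈ P.centers, Measurable (f c)) : Measurable (P.graft f) := by
  refine measurable_id.add (Finset.measurable_fun_sum _ fun c hc => ?_)
  have hzoom := (continuous_zoom c (P.radius c)).measurable
  exact (((hf c hc).comp hzoom).sub hzoom).const_smul (P.radius c)

theorem exists_lipschitzWith_sum {ι : Type*} {s : Finset ι} {F : ι → ℂ → ℂ}
    (h : ∀ i ∈ s, ∃ L, LipschitzWith L (F i)) :
    ∃ L, LipschitzWith L fun z => ∑ i ∈ s, F i z := by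
  classical
  induction s using Finset.induction_on with
  | empty => exact ⟨0, by simp⟩
  | insert i s hi ih =>
    obtain ⟨L₁, h₁⟩ := h i (Finset.mem_insert_self i s)
    obtain ⟨L₂, h₂⟩ := ih fun j hj => h j (Finset.mem_insert_of_mem hj)
    simp only [Finset.sum_insert hi]
    exact ⟨L₁ + L₂, h₁.add h₂⟩

theorem exists_lipschitzWith_graft (hf : ∀ c ∈ P.centers, ∃ L, LipschitzWith L (f c)) :
    ∃ L, LipschitzWith L (P.graft f) := by
  have hzoom : ∀ c, LipschitzWith ‖(P.radius c)⁻¹‖₊ (zoom c (P.radius c)) := fun c =>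
    LipschitzWith.of_dist_le_mul fun x y => by
      rw [zoom, zoom, dist_smul₀, dist_sub_right, coe_nnnorm]
  obtain ⟨C, hC⟩ := exists_lipschitzWith_sum (s := P.centers) (F := fun c z =>
      P.radius c • (f c (zoom c (P.radius c) z) - zoom c (P.radius c) z)) fun c hc => by
    obtain ⟨L, hL⟩ := hf c hc
    exact ⟨_, (lipschitzWith_smul (P.radius c)).comp ((hL.comp (hzoom c)).sub (hzoom c))⟩
  exact ⟨1 + C, LipschitzWith.id.add hC⟩

theorem norm_graft_sub_le (hf : ∀ c ∈ P.centers, IsDiscMap (f c)) {f' : ℂ → ℂ → ℂ}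
    (hf' : ∀ c ∈ P.centers, IsDiscMap (f' c)) {C : ℝ} (hC : 0 ≤ C)
    (h : ∀ c ∈ P.centers, ∀ w, ‖f c w - f' c w‖ ≤ C) (z : ℂ) :
    ‖P.graft f z - P.graft f' z‖ ≤ 1 / 2 * C := by
  obtain ⟨c, hc, hz⟩ | hz := P.exists_mem_closedBall_or_forall_notMem z
  · rw [P.graft_of_mem hf hc hz, P.graft_of_mem hf' hc hz, add_sub_add_left_eq_sub, ← smul_sub,
      norm_smul, Real.norm_of_nonneg (P.radius_pos c hc).le]
    exact mul_le_mul (P.radius_le c hc) (h c hc _) (norm_nonneg _) (by norm_num)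
  · rw [P.graft_of_notMem hf hz, P.graft_of_notMem hf' hz, sub_self, norm_zero]
    positivity

/-- On each disc `B(c, r)` of the packing: a radial stretching of the annulus
`r ^ p ≤ |z - c| ≤ r` onto `r ^ q ≤ |z - c| ≤ r`, and a copy of `g` from `B(c, r ^ p)` to
`B(c, r ^ q)`. -/
noncomputable def stretch (p q : ℝ) (g : ℂ → ℂ) : ℂ → ℂ :=
  P.graft fun c => discStretch (P.radius c ^ (p - 1)) (P.radius c ^ (q - 1)) g

variable {p q : ℝ} {g : ℂ → ℂ} {c : ℂ}

theorem radius_rpow_sub_one_le_one (hc : c ∈ P.centers) (hp : 1 ≤ p) :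
    P.radius c ^ (p - 1) ≤ 1 :=
  Real.rpow_le_one (P.radius_pos c hc).le (by linarith [P.radius_le c hc]) (sub_nonneg.2 hp)

theorem radius_rpow_sub_one_lt_one (hc : c ∈ P.centers) (hp : 1 < p) :
    P.radius c ^ (p - 1) < 1 :=
  Real.rpow_lt_one (P.radius_pos c hc).le (by linarith [P.radius_le c hc]) (sub_pos.2 hp)

theorem isDiscMap_discStretch (hp : 1 ≤ p) (hq : 1 ≤ q) (hg : IsDiscMap g) (hc : c ∈ P.centers) :
    IsDiscMap (discStretch (P.radius c ^ (p - 1)) (P.radius c ^ (q - 1)) g) :=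
  _root_.isDiscMap_discStretch (P.radius_rpow_pos hc _) (P.radius_rpow_sub_one_le_one hc hp)
    (P.radius_rpow_pos hc _) (P.radius_rpow_sub_one_le_one hc hq) hg

theorem isDiscMap_stretch (hp : 1 ≤ p) (hq : 1 ≤ q) (hg : IsDiscMap g) :
    IsDiscMap (P.stretch p q g) :=
  P.isDiscMap_graft fun _ hc => P.isDiscMap_discStretch hp hq hg hc

theorem stretch_of_zoom_mem (hp : 1 ≤ p) (hq : 1 ≤ q) (hg : IsDiscMap g) (hc : c ∈ P.centers)
    {z : ℂ} (hz : zoom c (P.radius c ^ p) z ∈ Metric.closedBall 0 1) :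
    P.stretch p q g z = c + P.radius c ^ q • g (zoom c (P.radius c ^ p) z) := by
  have hr := P.radius_pos c hc
  have hzoom : (P.radius c ^ (p - 1))⁻¹ • zoom c (P.radius c) z = zoom c (P.radius c ^ p) z := by
    rw [inv_smul_zoom, ← P.radius_rpow_eq hc]
  have hle : ‖zoom c (P.radius c) z‖ ≤ P.radius c ^ (p - 1) := by
    rw [← hzoom, mem_closedBall_zero_iff, norm_smul, norm_inv,
      Real.norm_of_nonneg (P.radius_rpow_pos hc _).le, inv_mul_le_one₀ (P.radius_rpow_pos hc _)]
      at hz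
    exact hz
  rw [stretch, P.graft_of_mem (fun _ hc => P.isDiscMap_discStretch hp hq hg hc) hc
    (P.mem_closedBall_of_zoom_rpow_mem hc hp hz), discStretch_of_norm_le hle, hzoom, smul_smul,
    ← P.radius_rpow_eq hc]

theorem stretch_congr {g' : ℂ → ℂ} {z : ℂ} (h : ∀ c ∈ P.centers,
    g (zoom c (P.radius c ^ p) z) = g' (zoom c (P.radius c ^ p) z)) :
    P.stretch p q g z = P.stretch p q g' z := by
  refine congrArg (z + ·) (Finset.sum_congr rfl fun c hc => ?_)
  refine congrArg (fun w => P.radius c • (w - _)) (discStretch_congr ?_)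
  rw [inv_smul_zoom, ← P.radius_rpow_eq hc]
  exact h c hc

theorem stretch_stretch (hp : 1 < p) (hq : 1 < q) (hg : IsDiscMap g) {h : ℂ → ℂ}
    (hh : IsDiscMap h) (hhg : ∀ z, h (g z) = z) (z : ℂ) :
    P.stretch q p h (P.stretch p q g z) = z :=
  P.graft_graft (fun _ hc => P.isDiscMap_discStretch hp.le hq.le hg hc)
    (fun _ hc => P.isDiscMap_discStretch hq.le hp.le hh hc)
    (fun _ hc => discStretch_discStretch (P.radius_rpow_pos hc _)
      (P.radius_rpow_sub_one_lt_one hc hp) (P.radius_rpow_pos hc _)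
      (P.radius_rpow_sub_one_lt_one hc hq) hg hh hhg) z

theorem exists_lipschitzWith_stretch (hp : 1 < p) (hg : IsDiscMap g)
    (hL : ∃ L, LipschitzWith L g) : ∃ L, LipschitzWith L (P.stretch p q g) :=
  P.exists_lipschitzWith_graft fun _ hc => exists_lipschitzWith_discStretch
    (P.radius_rpow_pos hc _) (P.radius_rpow_sub_one_lt_one hc hp) (P.radius_rpow_pos hc _) hg hL

theorem norm_stretch_sub_le (hp : 1 ≤ p) (hq : 1 ≤ q) (hg : IsDiscMap g) {g' : ℂ → ℂ}
    (hg' : IsDiscMap g') {C : ℝ} (h : ∀ z, ‖g z - g' z‖ ≤ C) (z : ℂ) :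
    ‖P.stretch p q g z - P.stretch p q g' z‖ ≤ 1 / 2 * C :=
  P.norm_graft_sub_le (fun _ hc => P.isDiscMap_discStretch hp hq hg hc)
    (fun _ hc => P.isDiscMap_discStretch hp hq hg' hc) ((norm_nonneg _).trans (h 0))
    (fun _ hc => norm_discStretch_sub_le (P.radius_rpow_pos hc _).le
      (P.radius_rpow_sub_one_le_one hc hq) h) z

theorem tendsto_stretch {G : ℕ → ℂ → ℂ} (h : ∀ z, Tendsto (fun m => G m z) atTop (𝓝 (g z)))
    (z : ℂ) : Tendsto (fun m => P.stretch p q (G m) z) atTop (𝓝 (P.stretch p q g z)) :=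
  (tendsto_finsetSum _ fun _ _ =>
    ((tendsto_discStretch h _).sub_const _).const_smul _).const_add z

end DiscPacking

/-- Iterated stretchings, taking `levelSet P p m n` to `levelSet P q m n`. -/
noncomputable def stretchIter (P : ℕ → DiscPacking) (p q : ℝ) : ℕ → ℕ → ℂ → ℂ
  | 0, _ => id
  | m + 1, n => (P n).stretch p q (stretchIter P p q m (n + 1))

/-- The limit of the iterated stretchings, taking `limitSet P p n` to `limitSet P q n`. For `p = 1`
it is discontinuous, since it shrinks each disc of the packings without stretching an annulus. -/
noncomputable def limitMap (P : ℕ → DiscPacking) (p q : ℝ) (n : ℕ) (z : ℂ) : ℂ :=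
  limUnder atTop fun m => stretchIter P p q m n z

section LimitMap

variable {P : ℕ → DiscPacking} {p q : ℝ}

theorem isDiscMap_stretchIter (hp : 1 ≤ p) (hq : 1 ≤ q) (m n : ℕ) :
    IsDiscMap (stretchIter P p q m n) := by
  induction m generalizing n with
  | zero => exact IsDiscMap.id
  | succ m ih => exact (P n).isDiscMap_stretch hp hq (ih (n + 1))

theorem measurable_stretchIter (m n : ℕ) : Measurable (stretchIter P p q m n) := by
  induction m generalizing n with
  | zero => exact measurable_id
  | succ m ih => exact (P n).measurable_graft fun c _ => measurable_discStretch (ih (n + 1))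

theorem exists_lipschitzWith_stretchIter (hp : 1 < p) (hq : 1 ≤ q) (m n : ℕ) :
    ∃ L, LipschitzWith L (stretchIter P p q m n) := by
  induction m generalizing n with
  | zero => exact ⟨1, LipschitzWith.id⟩
  | succ m ih =>
    exact (P n).exists_lipschitzWith_stretch hp (isDiscMap_stretchIter hp.le hq m _) (ih (n + 1))

theorem stretchIter_stretchIter (hp : 1 < p) (hq : 1 < q) (m n : ℕ) (z : ℂ) :
    stretchIter P q p m n (stretchIter P p q m n z) = z := by
  induction m generalizing n z with
  | zero => rfl
  | succ m ih =>
    exact (P n).stretch_stretch hp hq (isDiscMap_stretchIter hp.le hq.le _ _)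
      (isDiscMap_stretchIter hq.le hp.le _ _) (ih (n + 1)) z

theorem norm_stretchIter_sub_le (hp : 1 ≤ p) (hq : 1 ≤ q) {m k : ℕ} (hmk : m ≤ k) (n : ℕ) (z : ℂ) :
    ‖stretchIter P p q m n z - stretchIter P p q k n z‖ ≤ (1 / 2) ^ m * 2 := by
  induction m generalizing k n z with
  | zero =>
    rw [pow_zero, one_mul]
    exact (isDiscMap_stretchIter hp hq 0 n).norm_sub_le_two (isDiscMap_stretchIter hp hq k n) z
  | succ m ih =>
    obtain ⟨k, rfl⟩ := Nat.exists_eq_add_of_le' (Nat.one_le_of_lt hmk)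
    rw [pow_succ', mul_assoc]
    exact (P n).norm_stretch_sub_le hp hq (isDiscMap_stretchIter hp hq _ _)
      (isDiscMap_stretchIter hp hq _ _) (ih (by omega) (n + 1)) z

theorem tendsto_half_pow_mul_two : Tendsto (fun m : ℕ => (1 / 2 : ℝ) ^ m * 2) atTop (𝓝 0) := by
  simpa using (tendsto_pow_atTop_nhds_zero_of_lt_one (r := (1 / 2 : ℝ)) (by norm_num)
    (by norm_num)).mul_const 2

theorem tendsto_stretchIter (hp : 1 ≤ p) (hq : 1 ≤ q) (n : ℕ) (z : ℂ) :
    Tendsto (fun m => stretchIter P p q m n z) atTop (𝓝 (limitMap P p q n z)) := by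
  refine CauchySeq.tendsto_limUnder
    (cauchySeq_of_le_tendsto_0' _ (fun m k hmk => ?_) tendsto_half_pow_mul_two)
  rw [dist_eq_norm]
  exact norm_stretchIter_sub_le hp hq hmk n z

theorem norm_stretchIter_sub_limitMap_le (hp : 1 ≤ p) (hq : 1 ≤ q) (m n : ℕ) (z : ℂ) :
    ‖stretchIter P p q m n z - limitMap P p q n z‖ ≤ (1 / 2) ^ m * 2 := by
  refine le_of_tendsto (((tendsto_stretchIter hp hq n z).const_sub _).norm) ?_
  filter_upwards [eventually_ge_atTop m] with k hk
  exact norm_stretchIter_sub_le hp hq hk n z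

theorem isDiscMap_limitMap (hp : 1 ≤ p) (hq : 1 ≤ q) (n : ℕ) : IsDiscMap (limitMap P p q n) :=
  IsDiscMap.of_tendsto (fun m => isDiscMap_stretchIter hp hq m n) (tendsto_stretchIter hp hq n)

theorem measurable_limitMap (hp : 1 ≤ p) (hq : 1 ≤ q) (n : ℕ) : Measurable (limitMap P p q n) :=
  measurable_of_tendsto_metrizable (fun m => measurable_stretchIter m n)
    (tendsto_pi_nhds.2 (tendsto_stretchIter hp hq n))

theorem limitMap_eq_stretch (hp : 1 ≤ p) (hq : 1 ≤ q) (n : ℕ) (z : ℂ) :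
    limitMap P p q n z = (P n).stretch p q (limitMap P p q (n + 1)) z :=
  tendsto_nhds_unique ((tendsto_stretchIter hp hq n z).comp (tendsto_add_atTop_nat 1))
    ((P n).tendsto_stretch (tendsto_stretchIter hp hq (n + 1)) z)

theorem limitMap_of_zoom_mem (hp : 1 ≤ p) (hq : 1 ≤ q) {n : ℕ} {c z : ℂ} (hc : c ∈ (P n).centers)
    (hz : zoom c ((P n).radius c ^ p) z ∈ Metric.closedBall 0 1) :
    limitMap P p q n z = c + (P n).radius c ^ q •
      limitMap P p q (n + 1) (zoom c ((P n).radius c ^ p) z) := by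
  rw [limitMap_eq_stretch hp hq, (P n).stretch_of_zoom_mem hp hq (isDiscMap_limitMap hp hq _) hc hz]

theorem mapsTo_stretch_levelSet (hp : 1 ≤ p) (hq : 1 ≤ q) {g : ℂ → ℂ} (hg : IsDiscMap g) {m n : ℕ}
    (h : Set.MapsTo g (levelSet P p m (n + 1)) (levelSet P q m (n + 1))) :
    Set.MapsTo ((P n).stretch p q g) (levelSet P p (m + 1) n) (levelSet P q (m + 1) n) := by
  intro z hz
  obtain ⟨c, hc, hzc⟩ := mem_levelSet_succ.1 hz
  refine mem_levelSet_succ.2 ⟨c, hc, ?_⟩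
  rw [(P n).stretch_of_zoom_mem hp hq hg hc (levelSet_subset_closedBall hp _ _ hzc),
    zoom_add_smul ((P n).radius_rpow_pos hc q).ne']
  exact h hzc

theorem mapsTo_stretchIter_levelSet (hp : 1 ≤ p) (hq : 1 ≤ q) (m n : ℕ) :
    Set.MapsTo (stretchIter P p q m n) (levelSet P p m n) (levelSet P q m n) := by
  induction m generalizing n with
  | zero => exact Set.mapsTo_id _
  | succ m ih => exact mapsTo_stretch_levelSet hp hq (isDiscMap_stretchIter hp hq m _) (ih (n + 1))

theorem mapsTo_limitMap_levelSet (hp : 1 ≤ p) (hq : 1 ≤ q) (m n : ℕ) :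
    Set.MapsTo (limitMap P p q n) (levelSet P p m n) (levelSet P q m n) := by
  induction m generalizing n with
  | zero =>
    exact fun z hz => mem_closedBall_zero_iff.2
      ((isDiscMap_limitMap hp hq n).norm_le_one z (mem_closedBall_zero_iff.1 hz))
  | succ m ih =>
    rw [funext (limitMap_eq_stretch hp hq n)]
    exact mapsTo_stretch_levelSet hp hq (isDiscMap_limitMap hp hq _) (ih (n + 1))

theorem mapsTo_limitMap_limitSet (hp : 1 ≤ p) (hq : 1 ≤ q) (n : ℕ) :
    Set.MapsTo (limitMap P p q n) (limitSet P p n) (limitSet P q n) := fun _ hz =>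
  Set.mem_iInter.2 fun m => mapsTo_limitMap_levelSet hp hq m n (Set.mem_iInter.1 hz m)

theorem limitMap_eq_stretchIter (hp : 1 ≤ p) (hq : 1 ≤ q) (m n : ℕ) {z : ℂ}
    (hz : z ∉ levelSet P p m n) : limitMap P p q n z = stretchIter P p q m n z := by
  induction m generalizing n z with
  | zero =>
    rw [levelSet, mem_closedBall_zero_iff, not_le] at hz
    exact (isDiscMap_limitMap hp hq n).eq_self z hz
  | succ m ih =>
    rw [limitMap_eq_stretch hp hq, stretchIter]
    exact (P n).stretch_congr fun c hc =>
      ih (n + 1) fun h => hz (mem_levelSet_succ.2 ⟨c, hc, h⟩)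

theorem continuous_limitMap (hp : 1 < p) (hq : 1 ≤ q) (n : ℕ) : Continuous (limitMap P p q n) := by
  have hunif : TendstoUniformly (fun m => stretchIter P p q m n) (limitMap P p q n) atTop := by
    rw [Metric.tendstoUniformly_iff]
    intro ε hε
    filter_upwards [tendsto_half_pow_mul_two.eventually_lt_const hε] with m hm z
    rw [dist_comm, dist_eq_norm]
    exact (norm_stretchIter_sub_limitMap_le hp.le hq m n z).trans_lt hm
  exact hunif.continuous (Frequently.of_forall fun m =>
    (exists_lipschitzWith_stretchIter hp hq m n).choose_spec.continuous)

theorem limitMap_limitMap (hp : 1 < p) (hq : 1 < q) (n : ℕ) (z : ℂ) :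
    limitMap P q p n (limitMap P p q n z) = z := by
  refine tendsto_nhds_unique (((continuous_limitMap hq hp.le n).tendsto _).comp
    (tendsto_stretchIter hp.le hq.le n z)) ?_
  rw [tendsto_iff_norm_sub_tendsto_zero]
  refine squeeze_zero (fun _ => norm_nonneg _) (fun m => ?_) tendsto_half_pow_mul_two
  have hm := norm_stretchIter_sub_limitMap_le (P := P) hq.le hp.le m n (stretchIter P p q m n z)
  rwa [stretchIter_stretchIter hp hq, norm_sub_rev] at hm

theorem isHomeomorph_limitMap (hp : 1 < p) (hq : 1 < q) (n : ℕ) :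
    IsHomeomorph (limitMap P p q n) :=
  (Homeomorph.mk ⟨limitMap P p q n, limitMap P q p n, limitMap_limitMap hp hq n,
    limitMap_limitMap hq hp n⟩ (continuous_limitMap hp hq.le n)
    (continuous_limitMap hq hp.le n)).isHomeomorph

theorem image_limitMap_limitSet (hp : 1 < p) (hq : 1 < q) (n : ℕ) :
    limitMap P p q n '' limitSet P p n = limitSet P q n :=
  Set.Subset.antisymm (mapsTo_limitMap_limitSet hp.le hq.le n).image_subset fun w hw =>
    ⟨limitMap P q p n w, mapsTo_limitMap_limitSet hq.le hp.le n hw, limitMap_limitMap hq hp n w⟩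

end LimitMap

theorem hausdorffMeasure_pos_of_measure_le {X : Type*} [MetricSpace X] [MeasurableSpace X]
    [BorelSpace X] {μ : Measure X} {s : ℝ} {C : ℝ≥0∞} (hC : C ≠ ⊤)
    (hμ : ∀ A, IsClosed A → Metric.ediam A ≠ ⊤ → μ A ≤ C * Metric.ediam A ^ s)
    {E : Set X} (hE : 0 < μ E) : 0 < Measure.hausdorffMeasure s E := by
  have hle : (C + 1)⁻¹ • μ ≤ Measure.hausdorffMeasure s := by
    refine Measure.le_hausdorffMeasure _ _ 1 one_pos fun A hA => ?_
    rw [Measure.smul_apply, smul_eq_mul, ENNReal.inv_mul_le_iff (by simp) (by simp [hC]),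
      ← Metric.ediam_closure]
    have hfin : Metric.ediam (closure A) ≠ ⊤ := by
      rw [Metric.ediam_closure]
      exact ne_top_of_le_ne_top ENNReal.one_ne_top hA
    calc μ A ≤ μ (closure A) := measure_mono subset_closure
      _ ≤ C * Metric.ediam (closure A) ^ s := hμ _ isClosed_closure hfin
      _ ≤ (C + 1) * Metric.ediam (closure A) ^ s := by gcongr; exact le_self_add
  refine lt_of_lt_of_le ?_ (hle E)
  rw [Measure.smul_apply, smul_eq_mul]
  exact ENNReal.mul_pos (ENNReal.inv_ne_zero.2 (by simp [hC])) hE.ne'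

/-- The constant in the estimate of the mass of a set by a power of its diameter. -/
noncomputable def frostmanConst (p : ℝ) : ℝ := (3 / (1 - (1 / 2) ^ (p - 1))) ^ 2

theorem half_rpow_sub_one_lt_one {p : ℝ} (hp : 1 < p) : (1 / 2 : ℝ) ^ (p - 1) < 1 :=
  Real.rpow_lt_one (by norm_num) (by norm_num) (sub_pos.2 hp)

theorem one_le_frostmanConst {p : ℝ} (hp : 1 < p) : 1 ≤ frostmanConst p := by
  have hlt := half_rpow_sub_one_lt_one hp
  have hpos : (0 : ℝ) < (1 / 2) ^ (p - 1) := by positivity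
  refine one_le_pow₀ ((one_le_div (by linarith)).2 (by linarith))

namespace DiscPacking

variable (P : DiscPacking) {p d : ℝ} {A : Set ℂ}

open Classical in
/-- The centres of the discs `B(c, r)` of the packing for which `B(c, r ^ p)` meets `A`. -/
noncomputable def centersMeeting (p : ℝ) (A : Set ℂ) : Finset ℂ :=
  P.centers.filter fun c => ∃ a ∈ A, a ∈ Metric.closedBall c (P.radius c ^ p)

theorem mem_centersMeeting {c : ℂ} : c ∈ P.centersMeeting p A ↔
    c ∈ P.centers ∧ ∃ a ∈ A, a ∈ Metric.closedBall c (P.radius c ^ p) := by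
  simp only [centersMeeting, Finset.mem_filter]

theorem centersMeeting_subset : P.centersMeeting p A ⊆ P.centers :=
  fun _ hc => (P.mem_centersMeeting.1 hc).1

theorem radius_le_of_mem_centersMeeting (hp : 1 < p) (hA : ∀ x ∈ A, ∀ y ∈ A, dist x y ≤ d)
    {c c' : ℂ} (hc : c ∈ P.centersMeeting p A) (hc' : c' ∈ P.centersMeeting p A) (hne : c ≠ c') :
    P.radius c ≤ d / (1 - (1 / 2) ^ (p - 1)) := by
  obtain ⟨hc, a, haA, ha⟩ := P.mem_centersMeeting.1 hc
  obtain ⟨hc', a', haA', ha'⟩ := P.mem_centersMeeting.1 hc'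
  have hlt := half_rpow_sub_one_lt_one hp
  have hdist : P.radius c + P.radius c' < P.radius c ^ p + d + P.radius c' ^ p :=
    calc P.radius c + P.radius c' < dist c c' := P.disjoint c hc c' hc' hne
      _ ≤ dist c a + dist a a' + dist a' c' := dist_triangle4 c a a' c'
      _ ≤ P.radius c ^ p + d + P.radius c' ^ p :=
        add_le_add (add_le_add (Metric.mem_closedBall'.1 ha) (hA a haA a' haA'))
          (Metric.mem_closedBall.1 ha')
  rw [le_div_iff₀ (sub_pos.2 hlt)]
  linarith [P.radius_rpow_le hc hp.le, P.radius_rpow_le hc' hp.le,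
    mul_le_of_le_one_right (P.radius_pos c' hc').le hlt.le]

theorem sum_sq_centersMeeting_le_sq (hp : 1 < p) (hd : 0 ≤ d)
    (hA : ∀ x ∈ A, ∀ y ∈ A, dist x y ≤ d) (hs : (P.centersMeeting p A).Nontrivial) :
    ∑ c ∈ P.centersMeeting p A, P.radius c ^ 2 ≤ frostmanConst p * d ^ 2 := by
  have hκ : 0 < 1 - (1 / 2 : ℝ) ^ (p - 1) := sub_pos.2 (half_rpow_sub_one_lt_one hp)
  have hκ1 : d ≤ d / (1 - (1 / 2) ^ (p - 1)) :=
    le_div_self hd hκ (sub_le_self 1 (by positivity))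
  obtain ⟨c₀, hc₀⟩ := hs.nonempty
  obtain ⟨-, x₀, hx₀, -⟩ := P.mem_centersMeeting.1 hc₀
  rw [frostmanConst, ← mul_pow, div_mul_eq_mul_div, mul_div_assoc]
  refine P.sum_sq_le_of_subset P.centersMeeting_subset (x := x₀) (by positivity) fun c hc => ?_
  obtain ⟨c', hc', hne⟩ := hs.exists_ne c
  have hrad := P.radius_le_of_mem_centersMeeting hp hA hc hc' hne.symm
  obtain ⟨hc, a, haA, ha⟩ := P.mem_centersMeeting.1 hc
  refine Metric.closedBall_subset_closedBall' ?_
  linarith [dist_triangle c a x₀, hA a haA x₀ hx₀, Metric.mem_closedBall'.1 ha,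
    P.radius_rpow_le_radius hc hp.le]

theorem sum_sq_centersMeeting_le_rpow (hp : 1 < p) (hd : 0 ≤ d)
    (hA : ∀ x ∈ A, ∀ y ∈ A, dist x y ≤ d) (hs : (P.centersMeeting p A).Nontrivial) :
    ∑ c ∈ P.centersMeeting p A, P.radius c ^ 2 ≤ frostmanConst p * d ^ (2 / p) := by
  have hC := one_le_frostmanConst hp
  rcases le_total d 1 with hd1 | hd1
  · refine (P.sum_sq_centersMeeting_le_sq hp hd hA hs).trans ?_
    rw [← Real.rpow_two]
    refine mul_le_mul_of_nonneg_left ?_ (zero_le_one.trans hC)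
    exact Real.rpow_le_rpow_of_exponent_ge_of_imp hd hd1
      (div_le_self zero_le_two hp.le) fun _ h => absurd h (by positivity)
  · calc ∑ c ∈ P.centersMeeting p A, P.radius c ^ 2
        ≤ ∑ c ∈ P.centers, P.radius c ^ 2 :=
          Finset.sum_le_sum_of_subset_of_nonneg P.centersMeeting_subset fun _ _ _ => sq_nonneg _
      _ ≤ 1 := P.sum_sq_le_one
      _ ≤ frostmanConst p * d ^ (2 / p) :=
          one_le_mul_of_one_le_of_one_le hC (Real.one_le_rpow hd1 (by positivity))

end DiscPacking

/-- The image of the area on `limitSet P 1 n` under `limitMap P 1 p n`, a measure on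
`limitSet P p n`. -/
noncomputable def frostmanMeasure (P : ℕ → DiscPacking) (p : ℝ) (n : ℕ) : Measure ℂ :=
  (volume.restrict (limitSet P 1 n)).map (limitMap P 1 p n)

section Frostman

variable {P : ℕ → DiscPacking} {p : ℝ}

theorem frostmanMeasure_apply (hp : 1 ≤ p) (n : ℕ) {A : Set ℂ} (hA : MeasurableSet A) :
    frostmanMeasure P p n A = volume (limitSet P 1 n ∩ limitMap P 1 p n ⁻¹' A) := by
  have hmeas := measurable_limitMap (P := P) le_rfl hp n
  rw [frostmanMeasure, Measure.map_apply hmeas hA, Measure.restrict_apply (hmeas hA),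
    Set.inter_comm]

theorem frostmanMeasure_le_pi (hp : 1 ≤ p) (n : ℕ) {A : Set ℂ} (hA : MeasurableSet A) :
    frostmanMeasure P p n A ≤ ENNReal.ofReal Real.pi := by
  rw [frostmanMeasure_apply hp n hA]
  calc volume (limitSet P 1 n ∩ limitMap P 1 p n ⁻¹' A)
      ≤ volume (Metric.closedBall (0 : ℂ) 1) :=
        measure_mono (Set.inter_subset_left.trans (limitSet_subset_levelSet 0 n))
    _ = ENNReal.ofReal Real.pi := by
        rw [volume_closedBall_complex 0 zero_le_one, one_pow, mul_one]

theorem frostmanMeasure_limitSet_pos (hp : 1 ≤ p) {n : ℕ} (hvol : 0 < volume (limitSet P 1 n)) :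
    0 < frostmanMeasure P p n (limitSet P p n) := by
  rw [frostmanMeasure_apply hp n (isCompact_limitSet n).isClosed.measurableSet,
    Set.inter_eq_left.2 (mapsTo_limitMap_limitSet le_rfl hp n).subset_preimage]
  exact hvol

theorem limitSet_inter_preimage_subset (hp : 1 ≤ p) (n : ℕ) (A : Set ℂ) :
    limitSet P 1 n ∩ limitMap P 1 p n ⁻¹' A ⊆ ⋃ c ∈ (P n).centersMeeting p A,
      zoom c ((P n).radius c) ⁻¹' (limitSet P 1 (n + 1) ∩
        limitMap P 1 p (n + 1) ⁻¹' ((fun w => c + (P n).radius c ^ p • w) ⁻¹' A)) := by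
  rintro z ⟨hz, hzA⟩
  obtain ⟨c, hc, h⟩ := exists_zoom_mem_limitSet le_rfl hz
  have hball := limitSet_subset_levelSet 0 _ h
  have heq := limitMap_of_zoom_mem le_rfl hp hc hball
  rw [Real.rpow_one] at h heq hball
  have hmem : limitMap P 1 p n z ∈ Metric.closedBall c ((P n).radius c ^ p) := by
    have hr := (P n).radius_rpow_pos hc p
    rw [← zoom_mem_closedBall_iff hr, heq, zoom_add_smul hr.ne', mem_closedBall_zero_iff]
    exact (isDiscMap_limitMap le_rfl hp (n + 1)).norm_le_one _ (mem_closedBall_zero_iff.1 hball)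
  rw [Set.mem_preimage, heq] at hzA
  rw [heq] at hmem
  exact Set.mem_biUnion ((P n).mem_centersMeeting.2 ⟨hc, _, hzA, hmem⟩) ⟨h, hzA⟩

theorem frostmanMeasure_le_sum (hp : 1 ≤ p) (n : ℕ) {A : Set ℂ} (hA : MeasurableSet A) :
    frostmanMeasure P p n A ≤ ∑ c ∈ (P n).centersMeeting p A, ENNReal.ofReal ((P n).radius c ^ 2) *
      frostmanMeasure P p (n + 1) ((fun w => c + (P n).radius c ^ p • w) ⁻¹' A) := by
  rw [frostmanMeasure_apply hp n hA]
  refine (measure_mono (limitSet_inter_preimage_subset hp n A)).trans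
    ((measure_biUnion_finset_le _ _).trans_eq (Finset.sum_congr rfl fun c hc => ?_))
  rw [volume_zoom_preimage c ((P n).radius_pos c ((P n).centersMeeting_subset hc)),
    frostmanMeasure_apply hp _ (measurableSet_preimage (by fun_prop) hA)]

theorem dist_le_of_mem_preimage_add_smul {A : Set ℂ} {d ρ : ℝ} (hρ : 0 < ρ)
    (hA : ∀ x ∈ A, ∀ y ∈ A, dist x y ≤ d) (c : ℂ) :
    ∀ x ∈ (fun w => c + ρ • w) ⁻¹' A, ∀ y ∈ (fun w => c + ρ • w) ⁻¹' A, dist x y ≤ d / ρ := by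
  intro x hx y hy
  have := hA _ hx _ hy
  rw [dist_add_left, dist_smul₀, Real.norm_of_nonneg hρ.le] at this
  rwa [le_div_iff₀' hρ]

theorem frostmanMeasure_le (hp : 1 < p) (m n : ℕ) {A : Set ℂ} (hmeas : MeasurableSet A) {d : ℝ}
    (hd : 0 ≤ d) (hA : ∀ x ∈ A, ∀ y ∈ A, dist x y ≤ d) :
    frostmanMeasure P p n A ≤
      ENNReal.ofReal (Real.pi * max (frostmanConst p * d ^ (2 / p)) ((1 / 4) ^ m)) := by
  induction m generalizing n A d with
  | zero =>
    refine (frostmanMeasure_le_pi hp.le n hmeas).trans (ENNReal.ofReal_le_ofReal ?_)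
    exact le_mul_of_one_le_right Real.pi_pos.le (le_max_right _ _)
  | succ m ih =>
    refine (frostmanMeasure_le_sum hp.le n hmeas).trans ?_
    rcases ((P n).centersMeeting p A).eq_empty_or_nonempty with hs | hs
    · rw [hs, Finset.sum_empty]
      exact zero_le
    rcases hs.exists_eq_singleton_or_nontrivial with ⟨c, hs⟩ | hs
    · have hc := (P n).centersMeeting_subset (hs ▸ Finset.mem_singleton_self c)
      have hr := (P n).radius_rpow_pos hc p
      have hr0 := (P n).radius_pos c hc
      have hscale : (P n).radius c ^ 2 * (d / (P n).radius c ^ p) ^ (2 / p) = d ^ (2 / p) := by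
        rw [Real.div_rpow hd hr.le, ← Real.rpow_mul hr0.le, mul_div_cancel₀ _ (by linarith),
          Real.rpow_two, mul_div_cancel₀ _ (by positivity)]
      have hsq : (P n).radius c ^ 2 ≤ 1 / 4 := by
        nlinarith [(P n).radius_le c hc]
      rw [hs, Finset.sum_singleton]
      grw [ih (n + 1) (measurableSet_preimage (by fun_prop) hmeas) (by positivity)
        (dist_le_of_mem_preimage_add_smul hr hA c)]
      rw [← ENNReal.ofReal_mul (by positivity), mul_left_comm, mul_max_of_nonneg _ _ (sq_nonneg _),
        mul_left_comm _ (frostmanConst p), hscale, pow_succ' _ m]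
      gcongr
    · grw [Finset.sum_le_sum fun c _ => mul_le_mul_right (frostmanMeasure_le_pi hp.le (n + 1)
        (measurableSet_preimage (by fun_prop) hmeas)) _]
      rw [← Finset.sum_mul, ← ENNReal.ofReal_sum_of_nonneg fun c _ => sq_nonneg _,
        ← ENNReal.ofReal_mul (Finset.sum_nonneg fun c _ => sq_nonneg _), mul_comm]
      gcongr
      exact le_max_of_le_left ((P n).sum_sq_centersMeeting_le_rpow hp hd hA hs)

theorem frostmanMeasure_le_ediam_rpow (hp : 1 < p) (n : ℕ) {A : Set ℂ} (hA : IsClosed A)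
    (hfin : Metric.ediam A ≠ ⊤) : frostmanMeasure P p n A ≤
      ENNReal.ofReal (Real.pi * frostmanConst p) * Metric.ediam A ^ (2 / p) := by
  set d := (Metric.ediam A).toReal
  have hd : 0 ≤ d := ENNReal.toReal_nonneg
  have hp0 : 0 ≤ 2 / p := by positivity
  have hC := zero_le_one.trans (one_le_frostmanConst hp)
  have hdist : ∀ x ∈ A, ∀ y ∈ A, dist x y ≤ d := fun x hx y hy => by
    rw [dist_edist]
    exact ENNReal.toReal_mono hfin (Metric.edist_le_ediam_of_mem hx hy)
  have hlim : Tendsto (fun m : ℕ => ENNReal.ofReal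
      (Real.pi * max (frostmanConst p * d ^ (2 / p)) ((1 / 4) ^ m))) atTop
      (𝓝 (ENNReal.ofReal (Real.pi * max (frostmanConst p * d ^ (2 / p)) 0))) :=
    ENNReal.tendsto_ofReal ((tendsto_const_nhds.max
      (tendsto_pow_atTop_nhds_zero_of_lt_one (by norm_num) (by norm_num))).const_mul _)
  refine (ge_of_tendsto' hlim fun m =>
    frostmanMeasure_le hp m n hA.measurableSet hd hdist).trans_eq ?_
  rw [max_eq_left (by positivity), ← mul_assoc, ENNReal.ofReal_mul (by positivity),
    ← ENNReal.ofReal_rpow_of_nonneg hd hp0, ENNReal.ofReal_toReal hfin]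

theorem hausdorffMeasure_limitSet_pos (hp : 1 < p) {n : ℕ} (hvol : 0 < volume (limitSet P 1 n)) :
    0 < Measure.hausdorffMeasure (2 / p) (limitSet P p n) :=
  hausdorffMeasure_pos_of_measure_le ENNReal.ofReal_ne_top
    (fun _ hA hfin => frostmanMeasure_le_ediam_rpow hp n hA hfin)
    (frostmanMeasure_limitSet_pos hp.le hvol)

end Frostman

section Distortion

/-- The real-linear map `L` of the plane satisfies `L v = a v + b v̄` with
`|a| + |b| ≤ K (|a| - |b|)`, that is, it preserves orientation and its linear distortion
`max |L v| / min |L v|` over unit vectors is at most `K`. The case `L = 0` is included. -/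
def HasDistortionLE (K : ℝ) (L : ℂ →L[ℝ] ℂ) : Prop :=
  ∃ a b : ℂ, (∀ v, L v = a * v + b * (starRingEnd ℂ) v) ∧ ‖a‖ + ‖b‖ ≤ K * (‖a‖ - ‖b‖)

/-- `f` is differentiable at `z` with derivative of distortion at most `K`. -/
def DistortionLEAt (K : ℝ) (f : ℂ → ℂ) (z : ℂ) : Prop :=
  ∃ L, HasFDerivAt f L z ∧ HasDistortionLE K L

variable {K : ℝ} {L : ℂ →L[ℝ] ℂ} {f g : ℂ → ℂ} {z : ℂ}

theorem HasDistortionLE.norm_le_mul_norm (hK : 0 ≤ K) (hL : HasDistortionLE K L) {u v : ℂ}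
    (hu : ‖u‖ = 1) (hv : ‖v‖ = 1) : ‖L u‖ ≤ K * ‖L v‖ := by
  obtain ⟨a, b, hab, h⟩ := hL
  have hle : ‖L u‖ ≤ ‖a‖ + ‖b‖ := by
    rw [hab]
    refine (norm_add_le _ _).trans ?_
    rw [norm_mul, norm_mul, Complex.norm_conj, hu, mul_one, mul_one]
  have hge : ‖a‖ - ‖b‖ ≤ ‖L v‖ := by
    have := norm_sub_le_norm_add (a * v) (b * (starRingEnd ℂ) v)
    rwa [norm_mul, norm_mul, Complex.norm_conj, hv, mul_one, mul_one, ← hab] at this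
  exact hle.trans (h.trans (mul_le_mul_of_nonneg_left hge hK))

theorem det_eq_norm_sq_sub_norm_sq {a b : ℂ} (hL : ∀ v, L v = a * v + b * (starRingEnd ℂ) v) :
    L.det = ‖a‖ ^ 2 - ‖b‖ ^ 2 := by
  rw [ContinuousLinearMap.det, ← LinearMap.det_toMatrix Complex.basisOneI, Matrix.det_fin_two]
  simp [LinearMap.toMatrix_apply, hL, Complex.sq_norm, Complex.normSq_apply]
  ring

theorem HasDistortionLE.norm_sq_le (hL : HasDistortionLE K L) : ‖L‖ ^ 2 ≤ K * L.det := by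
  obtain ⟨a, b, hab, h⟩ := hL
  have hnorm : ‖L‖ ≤ ‖a‖ + ‖b‖ := by
    refine L.opNorm_le_bound (by positivity) fun v => ?_
    rw [hab, add_mul]
    refine (norm_add_le _ _).trans_eq ?_
    rw [norm_mul, norm_mul, Complex.norm_conj]
  calc ‖L‖ ^ 2 ≤ (‖a‖ + ‖b‖) ^ 2 := by gcongr
    _ ≤ K * (‖a‖ - ‖b‖) * (‖a‖ + ‖b‖) := by
      rw [sq]; exact mul_le_mul_of_nonneg_right h (by positivity)
    _ = K * L.det := by rw [det_eq_norm_sq_sub_norm_sq hab]; ring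

theorem hasDistortionLE_id (hK : 1 ≤ K) : HasDistortionLE K (ContinuousLinearMap.id ℝ ℂ) :=
  ⟨1, 0, fun v => by simp, by simpa using hK⟩

theorem HasDistortionLE.smul (hL : HasDistortionLE K L) {t : ℝ} (ht : 0 ≤ t) :
    HasDistortionLE K (t • L) := by
  obtain ⟨a, b, hab, h⟩ := hL
  refine ⟨t * a, t * b, fun v => ?_, ?_⟩
  · rw [smul_apply, hab, Complex.real_smul]; ring
  · rw [norm_mul, norm_mul, Complex.norm_real, Real.norm_of_nonneg ht]
    linarith [mul_le_mul_of_nonneg_left h ht]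

theorem DistortionLEAt.differentiableAt (h : DistortionLEAt K f z) : DifferentiableAt ℝ f z :=
  h.choose_spec.1.differentiableAt

theorem DistortionLEAt.fderiv (h : DistortionLEAt K f z) : HasDistortionLE K (fderiv ℝ f z) := by
  obtain ⟨L, hL, hK⟩ := h
  rwa [hL.fderiv]

theorem distortionLEAt_id (hK : 1 ≤ K) (z : ℂ) : DistortionLEAt K id z :=
  ⟨_, hasFDerivAt_id z, hasDistortionLE_id hK⟩

theorem DistortionLEAt.congr (h : DistortionLEAt K g z) (hfg : f =ᶠ[𝓝 z] g) :
    DistortionLEAt K f z := by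
  obtain ⟨L, hL, hK⟩ := h
  exact ⟨L, hL.congr_of_eventuallyEq hfg, hK⟩

theorem DistortionLEAt.const_smul (h : DistortionLEAt K f z) {t : ℝ} (ht : 0 ≤ t) :
    DistortionLEAt K (fun x => t • f x) z := by
  obtain ⟨L, hL, hK⟩ := h
  exact ⟨_, hL.const_smul t, hK.smul ht⟩

theorem DistortionLEAt.const_add (h : DistortionLEAt K f z) (c : ℂ) :
    DistortionLEAt K (fun x => c + f x) z := by
  obtain ⟨L, hL, hK⟩ := h
  exact ⟨L, hL.const_add c, hK⟩

theorem DistortionLEAt.comp_zoom {c : ℂ} {ρ : ℝ} (hρ : 0 ≤ ρ)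
    (h : DistortionLEAt K f (zoom c ρ z)) : DistortionLEAt K (fun x => f (zoom c ρ x)) z := by
  obtain ⟨L, hL, hK⟩ := h
  have hzoom : HasFDerivAt (zoom c ρ) (ρ⁻¹ • ContinuousLinearMap.id ℝ ℂ) z :=
    ((hasFDerivAt_id z).sub_const c).const_smul ρ⁻¹
  refine ⟨_, hL.comp z hzoom, ?_⟩
  rw [ContinuousLinearMap.comp_smul, ContinuousLinearMap.comp_id]
  exact hK.smul (inv_nonneg.2 hρ)

theorem lintegral_enorm_fderiv_sq_le (hg : ∀ᵐ z, DistortionLEAt K g z) (hK : 0 ≤ K)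
    (hinj : Function.Injective g) {S : Set ℂ} (hS : MeasurableSet S) :
    ∫⁻ z in S, ‖fderiv ℝ g z‖ₑ ^ 2 ≤ ENNReal.ofReal K * volume (g '' S) := by
  set T := S ∩ {z | DifferentiableAt ℝ g z}
  have hTm : MeasurableSet T := hS.inter (measurableSet_of_differentiableAt ℝ g)
  have hST : S =ᵐ[volume] T := by
    filter_upwards [hg] with z hz
    exact propext ⟨fun h => ⟨h, hz.differentiableAt⟩, fun h => h.1⟩
  rw [Measure.restrict_congr_set hST]
  calc ∫⁻ z in T, ‖fderiv ℝ g z‖ₑ ^ 2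
      ≤ ∫⁻ z in T, ENNReal.ofReal K * ENNReal.ofReal |(fderiv ℝ g z).det| := by
        refine lintegral_mono_ae (ae_restrict_of_ae ?_)
        filter_upwards [hg] with z hz
        rw [← ENNReal.ofReal_mul hK, ← ofReal_norm, ← ENNReal.ofReal_pow (norm_nonneg _)]
        exact ENNReal.ofReal_le_ofReal
          (hz.fderiv.norm_sq_le.trans (mul_le_mul_of_nonneg_left (le_abs_self _) hK))
    _ = ENNReal.ofReal K * volume (g '' T) := by
        rw [lintegral_const_mul' _ _ ENNReal.ofReal_ne_top,
          lintegral_abs_det_fderiv_eq_addHaar_image volume hTm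
            (fun z hz => hz.2.hasFDerivAt.hasFDerivWithinAt) hinj.injOn]
    _ ≤ ENNReal.ofReal K * volume (g '' S) := by gcongr; exact Set.inter_subset_left

theorem hasFDerivAt_norm_rpow_smul {E : Type*} [NormedAddCommGroup E] [InnerProductSpace ℝ E]
    (β : ℝ) {w : E} (hw : w ≠ 0) :
    HasFDerivAt (fun x : E => ‖x‖ ^ β • x) (‖w‖ ^ β • ContinuousLinearMap.id ℝ E +
      (β * (‖w‖ ^ β / ‖w‖ ^ 2)) • (innerSL ℝ w).smulRight w) w := by
  have hsq : ∀ x : E, ‖x‖ ^ β = (‖x‖ ^ 2) ^ (β / 2) := fun x => by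
    rw [← Real.rpow_natCast, ← Real.rpow_mul (norm_nonneg _), Nat.cast_two,
      mul_div_cancel₀ _ two_ne_zero]
  have hw2 : ‖w‖ ^ 2 ≠ 0 := by positivity
  have hnorm := (hasStrictFDerivAt_norm_sq w).hasFDerivAt.rpow_const (p := β / 2) (Or.inl hw2)
  rw [Real.rpow_sub_one hw2] at hnorm
  simp only [← hsq] at hnorm
  refine (hnorm.smul (hasFDerivAt_id w)).congr_fderiv ?_
  ext v
  simp only [add_apply, smul_apply, ContinuousLinearMap.smulRight_apply, id_eq, nsmul_eq_mul,
    ContinuousLinearMap.id_apply, innerSL_apply_apply, smul_smul, smul_eq_mul]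
  congr 2
  push_cast
  ring

theorem mul_inner_eq (w v : ℂ) :
    w * (inner ℝ w v : ℝ) = ((‖w‖ ^ 2 : ℝ) * v + w ^ 2 * (starRingEnd ℂ) v) / 2 := by
  have hinner : ((inner ℝ w v : ℝ) : ℂ) =
      ((starRingEnd ℂ) w * v + w * (starRingEnd ℂ) v) / 2 := by
    rw [Complex.inner, Complex.re_eq_add_conj, map_mul, Complex.conj_conj]
    ring
  rw [hinner, Complex.ofReal_pow, ← Complex.mul_conj']
  ring

theorem distortionLEAt_norm_rpow_smul {β : ℝ} (hβ₀ : β ≤ 0) (hβ₁ : -1 ≤ β)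
    (hK : 1 ≤ K * (1 + β)) {w : ℂ} (hw : w ≠ 0) :
    DistortionLEAt K (fun x : ℂ => ‖x‖ ^ β • x) w := by
  have hpos : 0 < ‖w‖ ^ β := Real.rpow_pos_of_pos (norm_pos_iff.2 hw) β
  have hw2 : ((‖w‖ : ℂ)) ≠ 0 := by simpa using hw
  refine ⟨_, hasFDerivAt_norm_rpow_smul β hw, (‖w‖ ^ β * (1 + β / 2) : ℝ),
    (β / 2 * (‖w‖ ^ β / ‖w‖ ^ 2) : ℝ) * w ^ 2, fun v => ?_, ?_⟩
  · simp only [add_apply, smul_apply, ContinuousLinearMap.smulRight_apply,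
      ContinuousLinearMap.id_apply, innerSL_apply_apply, Complex.real_smul]
    have := mul_inner_eq w v
    push_cast at this ⊢
    rw [mul_comm ((inner ℝ w v : ℝ) : ℂ) w, this]
    field_simp
    ring
  · have ha : ‖((‖w‖ ^ β * (1 + β / 2) : ℝ) : ℂ)‖ = ‖w‖ ^ β * (1 + β / 2) := by
      rw [Complex.norm_real, Real.norm_of_nonneg (mul_nonneg hpos.le (by linarith))]
    have hb : ‖((β / 2 * (‖w‖ ^ β / ‖w‖ ^ 2) : ℝ) : ℂ) * w ^ 2‖ = ‖w‖ ^ β * (-β / 2) := by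
      rw [norm_mul, norm_pow, Complex.norm_real, Real.norm_of_nonpos
        (mul_nonpos_of_nonpos_of_nonneg (by linarith) (by positivity))]
      field_simp
    rw [ha, hb]
    linarith [mul_le_mul_of_nonneg_left hK hpos.le]

theorem ae_zoom {c : ℂ} {ρ : ℝ} (hρ : 0 < ρ) {p : ℂ → Prop} (hp : ∀ᵐ z, p z) :
    ∀ᵐ z, p (zoom c ρ z) := by
  rw [ae_iff] at hp ⊢
  have := volume_zoom_preimage c hρ {z | ¬ p z}
  rwa [hp, mul_zero] at this

theorem ae_norm_sub_ne (c : ℂ) {ρ : ℝ} (hρ : ρ ≠ 0) : ∀ᵐ z : ℂ, ‖z - c‖ ≠ ρ := by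
  have h := Measure.addHaar_sphere_of_ne_zero (volume : Measure ℂ) c hρ
  rw [ae_iff]
  convert h using 2
  ext z
  simp

theorem ae_distortionLEAt_discStretch {a b : ℝ} (hK : 1 ≤ K) (ha : 0 < a) (ha1 : a < 1)
    (hb : 0 ≤ b) (hab₁ : Real.logb a b ≤ 1) (hab₀ : 0 ≤ Real.logb a b)
    (habK : 1 ≤ K * Real.logb a b) (hgK : ∀ᵐ z, DistortionLEAt K g z) :
    ∀ᵐ z, DistortionLEAt K (discStretch a b g) z := by
  have hne : ∀ {ρ : ℝ}, ρ ≠ 0 → ∀ᵐ z : ℂ, ‖z‖ ≠ ρ := fun hρ => by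
    simpa only [sub_zero] using ae_norm_sub_ne 0 hρ
  filter_upwards [hne ha.ne', hne one_ne_zero, ae_zoom (c := 0) ha hgK] with z hza hz1 hz
  have hcont : ContinuousAt (fun z : ℂ => ‖z‖) z := continuous_norm.continuousAt
  rcases hza.lt_or_gt with hlt | hgt
  · refine ((hz.comp_zoom ha.le).const_smul hb).congr ?_
    filter_upwards [hcont.eventually_lt_const hlt] with x hx
    rw [discStretch_of_norm_le hx.le, zoom, sub_zero]
  rcases hz1.lt_or_gt with hlt1 | hgt1
  · refine (distortionLEAt_norm_rpow_smul (β := Real.logb a b - 1) (by linarith) (by linarith)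
      (by rwa [add_sub_cancel]) (norm_pos_iff.1 (ha.trans hgt))).congr ?_
    filter_upwards [hcont.eventually_lt_const hlt1, hcont.eventually_const_lt hgt] with x hx1 hxa
    exact discStretch_of_mem_annulus hxa hx1.le
  · refine (distortionLEAt_id hK z).congr ?_
    filter_upwards [hcont.eventually_const_lt hgt1] with x hx
    rw [discStretch, if_neg (ha1.trans hx).not_ge, min_eq_right hx.le, Real.one_rpow, one_smul,
      id]

theorem DiscPacking.ae_distortionLEAt_graft (P : DiscPacking) {f : ℂ → ℂ → ℂ} (hK : 1 ≤ K)
    (hf : ∀ c ∈ P.centers, IsDiscMap (f c))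
    (hfK : ∀ c ∈ P.centers, ∀ᵐ z, DistortionLEAt K (f c) z) :
    ∀ᵐ z, DistortionLEAt K (P.graft f) z := by
  have hne : ∀ᵐ z : ℂ, ∀ c ∈ P.centers, ‖z - c‖ ≠ P.radius c :=
    (Finset.eventually_all _).2 fun c hc => ae_norm_sub_ne c (P.radius_pos c hc).ne'
  have hzoom : ∀ᵐ z : ℂ, ∀ c ∈ P.centers, DistortionLEAt K (f c) (zoom c (P.radius c) z) :=
    (Finset.eventually_all _).2 fun c hc => ae_zoom (P.radius_pos c hc) (hfK c hc)
  filter_upwards [hne, hzoom] with z hne hzoom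
  obtain ⟨c, hc, hz⟩ | hz := P.exists_mem_closedBall_or_forall_notMem z
  · have hr := (P.radius_pos c hc).le
    refine ((((hzoom c hc).comp_zoom hr).const_smul hr).const_add c).congr ?_
    have hball : Metric.closedBall c (P.radius c) ∈ 𝓝 z := Metric.closedBall_mem_nhds_of_mem
      (mem_ball_iff_norm.2 ((mem_closedBall_iff_norm.1 hz).lt_of_ne (hne c hc)))
    filter_upwards [hball] with x hx
    exact P.graft_of_mem hf hc hx
  · refine (distortionLEAt_id hK z).congr ?_
    have hout : ∀ᶠ x in 𝓝 z, ∀ c ∈ P.centers, x ∉ Metric.closedBall c (P.radius c) :=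
      (Finset.eventually_all _).2 fun c hc =>
        Metric.isClosed_closedBall.isOpen_compl.mem_nhds (hz c hc)
    filter_upwards [hout] with x hx
    exact P.graft_of_notMem hf hx

end Distortion

section StretchDistortion

variable {K p q : ℝ}

theorem DiscPacking.logb_radius_rpow (P : DiscPacking) {c : ℂ} (hc : c ∈ P.centers) (p q : ℝ) :
    Real.logb (P.radius c ^ p) (P.radius c ^ q) = q / p := by
  have hr := P.radius_pos c hc
  have hlog : Real.log (P.radius c) ≠ 0 :=
    (Real.log_neg hr (by linarith [P.radius_le c hc])).ne
  rw [Real.logb, Real.log_rpow hr, Real.log_rpow hr, mul_div_mul_right _ _ hlog]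

theorem DiscPacking.ae_distortionLEAt_stretch (P : DiscPacking) (hK : 1 ≤ K) (hq : 1 < q)
    (hp : p - 1 = K * (q - 1)) {g : ℂ → ℂ} (hg : IsDiscMap g)
    (hgK : ∀ᵐ z, DistortionLEAt K g z) : ∀ᵐ z, DistortionLEAt K (P.stretch p q g) z := by
  have hK0 : 0 < K := one_pos.trans_le hK
  have hp1 : 1 < p := by linarith [mul_pos hK0 (sub_pos.2 hq)]
  refine P.ae_distortionLEAt_graft hK
    (fun c hc => P.isDiscMap_discStretch hp1.le hq.le hg hc) fun c hc => ?_
  have hlogb : Real.logb (P.radius c ^ (p - 1)) (P.radius c ^ (q - 1)) = 1 / K := by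
    have := (sub_pos.2 hq).ne'
    rw [P.logb_radius_rpow hc, hp]
    field_simp
  refine ae_distortionLEAt_discStretch hK (P.radius_rpow_pos hc _)
    (P.radius_rpow_sub_one_lt_one hc hp1) (P.radius_rpow_pos hc _).le ?_ ?_ ?_ hgK <;> rw [hlogb]
  · exact (div_le_one hK0).2 hK
  · positivity
  · exact (mul_one_div_cancel hK0.ne').ge

theorem ae_distortionLEAt_stretchIter {P : ℕ → DiscPacking} (hK : 1 ≤ K) (hq : 1 < q)
    (hp : p - 1 = K * (q - 1)) (m n : ℕ) :
    ∀ᵐ z, DistortionLEAt K (stretchIter P p q m n) z := by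
  have hp1 : 1 ≤ p := by linarith [mul_nonneg (zero_le_one.trans hK) (sub_pos.2 hq).le]
  induction m generalizing n with
  | zero => exact Eventually.of_forall (distortionLEAt_id hK)
  | succ m ih =>
    exact (P n).ae_distortionLEAt_stretch hK hq hp (isDiscMap_stretchIter hp1 hq.le m _)
      (ih (n + 1))

end StretchDistortion

section WeakDerivative

variable {F : Type*} [NormedAddCommGroup F]

theorem MemL2Loc.locallyIntegrable {f : ℂ → F} (hf : MemL2Loc f) : LocallyIntegrable f := by
  rw [locallyIntegrable_iff]
  intro S hS
  have : IsFiniteMeasure (volume.restrict S) := isFiniteMeasure_restrict.2 hS.measure_ne_top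
  exact (hf S hS).integrable one_le_two

theorem memL2Loc_of_continuous [SecondCountableTopology F] {f : ℂ → F} (hf : Continuous f) :
    MemL2Loc f := by
  intro S hS
  obtain ⟨C, hC⟩ := hS.exists_bound_of_continuousOn hf.continuousOn
  have : IsFiniteMeasure (volume.restrict S) := isFiniteMeasure_restrict.2 hS.measure_ne_top
  exact MemLp.of_bound hf.aestronglyMeasurable C
    ((ae_restrict_iff' hS.measurableSet).2 (Eventually.of_forall hC))

theorem memL2Loc_fderiv_of_ae_distortionLEAt {K : ℝ} {f : ℂ → ℂ} (hK : 0 ≤ K)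
    (hf : ∀ᵐ z, DistortionLEAt K f z) (hc : Continuous f) (hinj : Function.Injective f) :
    MemL2Loc (fderiv ℝ f) := by
  intro S hS
  refine ⟨(measurable_fderiv ℝ f).aestronglyMeasurable, ?_⟩
  rw [eLpNorm_lt_top_iff_lintegral_rpow_enorm_lt_top two_ne_zero ENNReal.ofNat_ne_top]
  simp only [ENNReal.toReal_ofNat, ENNReal.rpow_two]
  exact (lintegral_enorm_fderiv_sq_le hf hK hinj hS.measurableSet).trans_lt
    (ENNReal.mul_lt_top ENNReal.ofReal_lt_top (hS.image hc).measure_lt_top)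

theorem locallyIntegrable_clm_apply [NormedSpace ℝ F] {D : ℂ → ℂ →L[ℝ] F}
    (hD : LocallyIntegrable D) (v : ℂ) : LocallyIntegrable fun z => D z v := by
  rw [locallyIntegrable_iff] at hD ⊢
  exact fun S hS => (ContinuousLinearMap.apply ℝ F v).integrable_comp (hD S hS)

theorem locallyIntegrable_fderiv_of_lipschitzWith {f : ℂ → ℂ} {C : ℝ≥0}
    (hf : LipschitzWith C f) : LocallyIntegrable (fderiv ℝ f) :=
  (locallyIntegrable_const (C : ℝ)).mono (measurable_fderiv ℝ f).aestronglyMeasurable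
    (Eventually.of_forall fun z => by
      rw [NNReal.norm_eq]; exact norm_fderiv_le_of_lipschitz ℝ hf)

theorem integral_fderiv_mul_of_lipschitzWith {u : ℂ → ℝ} {C : ℝ≥0} (hu : LipschitzWith C u)
    {η : ℂ → ℝ} (hη : ContDiff ℝ ∞ η) (hηc : HasCompactSupport η) (v : ℂ) :
    ∫ z, fderiv ℝ η z v * u z = - ∫ z, η z * fderiv ℝ u z v := by
  obtain ⟨L, hL⟩ := ContDiff.lipschitzWith_of_hasCompactSupport hηc hη (by simp)
  have hparts := hu.integral_lineDeriv_mul_eq (μ := volume) hL hηc v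
  have hη' : ∀ z, lineDeriv ℝ η z (-v) = -fderiv ℝ η z v := fun z => by
    rw [(hη.differentiable (by simp) z).lineDeriv_eq_fderiv, map_neg]
  have hu' : ∀ᵐ z, lineDeriv ℝ u z v * η z = η z * fderiv ℝ u z v := by
    filter_upwards [hu.ae_differentiableAt (μ := volume)] with z hz
    rw [hz.lineDeriv_eq_fderiv, mul_comm]
  simp only [hη', neg_mul, integral_neg] at hparts
  rw [← integral_congr_ae hu', hparts, neg_neg]

theorem hasWeakFDeriv_of_lipschitzWith {f : ℂ → ℂ} {C : ℝ≥0} (hf : LipschitzWith C f) :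
    HasWeakFDeriv f (fderiv ℝ f) := by
  have hD := locallyIntegrable_fderiv_of_lipschitzWith hf
  refine ⟨hf.continuous.locallyIntegrable, hD, fun η hη hηc v => ?_⟩
  have hleft : Integrable fun z => fderiv ℝ η z v • f z :=
    (((hη.continuous_fderiv (by simp)).clm_apply continuous_const).smul
      hf.continuous).integrable_of_hasCompactSupport (hηc.fderiv_apply ℝ v).smul_right
  have hright : Integrable fun z => η z • fderiv ℝ f z v :=
    (locallyIntegrable_clm_apply hD v).integrable_smul_left_of_hasCompactSupport hη.continuous hηc
  have hcomp : ∀ ℓ : ℂ →L[ℝ] ℝ,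
      ℓ (∫ z, fderiv ℝ η z v • f z) = ℓ (- ∫ z, η z • fderiv ℝ f z v) := fun ℓ => by
    have hℓ : ∀ᵐ z, η z * fderiv ℝ (ℓ ∘ f) z v = ℓ (η z • fderiv ℝ f z v) := by
      filter_upwards [hf.ae_differentiableAt (μ := volume)] with z hz
      rw [(ℓ.hasFDerivAt.comp z hz.hasFDerivAt).fderiv, map_smul]
      rfl
    rw [map_neg, ← ℓ.integral_comp_comm hleft, ← ℓ.integral_comp_comm hright,
      ← integral_congr_ae hℓ, ← integral_fderiv_mul_of_lipschitzWith (ℓ.lipschitz.comp hf) hη hηc]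
    simp only [map_smul, smul_eq_mul, Function.comp_apply]
  exact Complex.ext (hcomp Complex.reCLM) (hcomp Complex.imCLM)

/-- Convergence of `f m` to `g` in `L¹` on compact sets. -/
def TendstoL1Loc (f : ℕ → ℂ → F) (g : ℂ → F) : Prop :=
  ∀ S : Set ℂ, IsCompact S → Tendsto (fun m => ∫⁻ z in S, ‖f m z - g z‖ₑ) atTop (𝓝 0)

variable {f : ℕ → ℂ → F} {g : ℂ → F}

theorem tendstoL1Loc_of_norm_sub_le {ε : ℕ → ℝ} (hε : Tendsto ε atTop (𝓝 0))
    (h : ∀ m z, ‖f m z - g z‖ ≤ ε m) : TendstoL1Loc f g := by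
  intro S hS
  have hlim : Tendsto (fun m => ENNReal.ofReal (ε m) * volume S) atTop (𝓝 0) := by
    simpa using ENNReal.Tendsto.mul_const (ENNReal.tendsto_ofReal hε)
      (Or.inr hS.measure_ne_top)
  refine tendsto_of_tendsto_of_tendsto_of_le_of_le tendsto_const_nhds hlim (fun _ => zero_le)
    fun m => ?_
  rw [← setLIntegral_const]
  refine lintegral_mono fun z => ?_
  rw [← ofReal_norm]
  exact ENNReal.ofReal_le_ofReal (h m z)

theorem TendstoL1Loc.clm_apply [NormedSpace ℝ F] {D : ℕ → ℂ → ℂ →L[ℝ] F} {D' : ℂ → ℂ →L[ℝ] F}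
    (h : TendstoL1Loc D D') (v : ℂ) : TendstoL1Loc (fun m z => D m z v) fun z => D' z v := by
  intro S hS
  have hlim := ENNReal.Tendsto.mul_const (h S hS) (Or.inr (enorm_ne_top (x := v)))
  rw [zero_mul] at hlim
  refine tendsto_of_tendsto_of_tendsto_of_le_of_le tendsto_const_nhds hlim (fun _ => zero_le)
    fun m => ?_
  rw [← lintegral_mul_const' _ _ enorm_ne_top]
  exact lintegral_mono fun z => ((D m z - D' z).le_opENorm v)

theorem TendstoL1Loc.tendsto_integral_smul [NormedSpace ℝ F] (h : TendstoL1Loc f g)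
    (hf : ∀ m, LocallyIntegrable (f m)) (hg : LocallyIntegrable g) {η : ℂ → ℝ}
    (hη : Continuous η) (hηc : HasCompactSupport η) :
    Tendsto (fun m => ∫ z, η z • f m z) atTop (𝓝 (∫ z, η z • g z)) := by
  obtain ⟨M, hM⟩ := hηc.exists_bound_of_continuous hη
  have hlim := ENNReal.Tendsto.const_mul (h _ hηc) (Or.inr (ENNReal.ofReal_ne_top (r := M)))
  rw [mul_zero] at hlim
  refine tendsto_integral_of_L1 _
    (hg.integrable_smul_left_of_hasCompactSupport hη hηc).aestronglyMeasurable
    (Eventually.of_forall fun m => (hf m).integrable_smul_left_of_hasCompactSupport hη hηc)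
    (tendsto_of_tendsto_of_tendsto_of_le_of_le tendsto_const_nhds hlim (fun _ => zero_le)
      fun m => ?_)
  rw [← lintegral_const_mul' _ _ ENNReal.ofReal_ne_top,
    ← lintegral_indicator (isClosed_tsupport η).measurableSet]
  refine lintegral_mono fun z => ?_
  by_cases hz : z ∈ tsupport η
  · rw [Set.indicator_of_mem hz, ← smul_sub, enorm_smul, ← ofReal_norm (η z)]
    gcongr
    exact hM z
  · rw [image_eq_zero_of_notMem_tsupport hz, zero_smul, zero_smul, sub_zero, enorm_zero]
    exact zero_le

theorem HasWeakFDeriv.of_tendsto {f : ℕ → ℂ → ℂ} {g : ℂ → ℂ} {D : ℕ → ℂ → ℂ →L[ℝ] ℂ}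
    {D' : ℂ → ℂ →L[ℝ] ℂ} (hf : ∀ m, HasWeakFDeriv (f m) (D m)) (hfg : TendstoL1Loc f g)
    (hD : TendstoL1Loc D D') (hg : LocallyIntegrable g) (hD' : LocallyIntegrable D') :
    HasWeakFDeriv g D' := by
  refine ⟨hg, hD', fun η hη hηc v => ?_⟩
  have hleft := hfg.tendsto_integral_smul (fun m => (hf m).1) hg
    ((hη.continuous_fderiv (by simp)).clm_apply continuous_const) (hηc.fderiv_apply ℝ v)
  have hright := (hD.clm_apply v).tendsto_integral_smul
    (fun m => locallyIntegrable_clm_apply (hf m).2.1 v) (locallyIntegrable_clm_apply hD' v)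
    hη.continuous hηc
  exact tendsto_nhds_unique hleft (hright.neg.congr fun m => ((hf m).2.2 η hη hηc v).symm)

end WeakDerivative

section Quasiconformal

variable {P : ℕ → DiscPacking} {K p q : ℝ}

/-- The bound of `volume_levelSet_le` for the area of `levelSet P p m n`. -/
noncomputable def levelArea (p : ℝ) (m : ℕ) : ℝ≥0∞ :=
  ENNReal.ofReal (Real.pi * (((1 / 2) ^ (p - 1)) ^ 2) ^ m)

theorem tendsto_levelArea (hp : 1 < p) : Tendsto (levelArea p) atTop (𝓝 0) := by
  have hlt : (((1 / 2 : ℝ) ^ (p - 1)) ^ 2) < 1 := pow_lt_one₀ (by positivity)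
    (Real.rpow_lt_one (by norm_num) (by norm_num) (sub_pos.2 hp)) two_ne_zero
  rw [← ENNReal.ofReal_zero, ← mul_zero Real.pi]
  exact ENNReal.tendsto_ofReal
    ((tendsto_pow_atTop_nhds_zero_of_lt_one (by positivity) hlt).const_mul _)

theorem volume_limitSet_eq_zero (hp : 1 < p) (n : ℕ) : volume (limitSet P p n) = 0 :=
  le_antisymm (ge_of_tendsto' (tendsto_levelArea hp) fun m =>
    (measure_mono (limitSet_subset_levelSet m n)).trans (volume_levelSet_le hp.le m n)) zero_le

theorem limitMap_eventuallyEq_stretchIter (hp : 1 ≤ p) (hq : 1 ≤ q) {m n : ℕ} {z : ℂ}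
    (hz : z ∉ levelSet P p m n) : limitMap P p q n =ᶠ[𝓝 z] stretchIter P p q m n := by
  filter_upwards [(isClosed_levelSet m n).isOpen_compl.mem_nhds hz] with x hx
  exact limitMap_eq_stretchIter hp hq m n hx

theorem ae_distortionLEAt_limitMap (hK : 1 ≤ K) (hq : 1 < q) (hp : p - 1 = K * (q - 1)) (n : ℕ) :
    ∀ᵐ z, DistortionLEAt K (limitMap P p q n) z := by
  have hp1 : 1 < p := by linarith [mul_pos (one_pos.trans_le hK) (sub_pos.2 hq)]
  filter_upwards [measure_eq_zero_iff_ae_notMem.1 (volume_limitSet_eq_zero (P := P) hp1 n),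
    ae_all_iff.2 fun m => ae_distortionLEAt_stretchIter (P := P) hK hq hp m n] with z hz hm
  obtain ⟨m, hzm⟩ : ∃ m, z ∉ levelSet P p m n := by
    simpa only [limitSet, Set.mem_iInter, not_forall] using hz
  exact (hm m).congr (limitMap_eventuallyEq_stretchIter hp1.le hq.le hzm)

theorem enorm_le_one_add_sq (x : ℝ≥0∞) : x ≤ 1 + x ^ 2 := by
  rcases le_total x 1 with h | h
  · exact h.trans le_self_add
  · exact (le_self_pow₀ h two_ne_zero).trans le_add_self

theorem lintegral_levelSet_enorm_fderiv_le (hK : 0 ≤ K) (hp : 1 ≤ p) (hq : 1 ≤ q) {g : ℂ → ℂ}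
    (hg : ∀ᵐ z, DistortionLEAt K g z) (hinj : Function.Injective g) {m n : ℕ}
    (hm : Set.MapsTo g (levelSet P p m n) (levelSet P q m n)) :
    ∫⁻ z in levelSet P p m n, ‖fderiv ℝ g z‖ₑ ≤
      levelArea p m + ENNReal.ofReal K * levelArea q m := by
  calc ∫⁻ z in levelSet P p m n, ‖fderiv ℝ g z‖ₑ
      ≤ ∫⁻ z in levelSet P p m n, (1 + ‖fderiv ℝ g z‖ₑ ^ 2) :=
        lintegral_mono fun z => enorm_le_one_add_sq _
    _ = volume (levelSet P p m n) + ∫⁻ z in levelSet P p m n, ‖fderiv ℝ g z‖ₑ ^ 2 := by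
        rw [lintegral_add_left measurable_const, setLIntegral_one]
    _ ≤ volume (levelSet P p m n) + ENNReal.ofReal K * volume (g '' levelSet P p m n) := by
        gcongr
        exact lintegral_enorm_fderiv_sq_le hg hK hinj (isClosed_levelSet m n).measurableSet
    _ ≤ levelArea p m + ENNReal.ofReal K * levelArea q m := by
        gcongr
        · exact volume_levelSet_le hp m n
        · exact (measure_mono hm.image_subset).trans (volume_levelSet_le hq m n)

theorem lintegral_enorm_fderiv_stretchIter_sub_le (hK : 1 ≤ K) (hq : 1 < q)
    (hp : p - 1 = K * (q - 1)) (m n : ℕ) :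
    ∫⁻ z, ‖fderiv ℝ (stretchIter P p q m n) z - fderiv ℝ (limitMap P p q n) z‖ₑ ≤
      2 * (levelArea p m + ENNReal.ofReal K * levelArea q m) := by
  have hK0 : 0 < K := one_pos.trans_le hK
  have hp1 : 1 < p := by linarith [mul_pos hK0 (sub_pos.2 hq)]
  set U := levelSet P p m n
  have hoff : ∀ z ∉ U,
      ‖fderiv ℝ (stretchIter P p q m n) z - fderiv ℝ (limitMap P p q n) z‖ₑ = 0 := fun z hz => by
    rw [(limitMap_eventuallyEq_stretchIter hp1.le hq.le hz).fderiv_eq, sub_self, enorm_zero]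
  calc ∫⁻ z, ‖fderiv ℝ (stretchIter P p q m n) z - fderiv ℝ (limitMap P p q n) z‖ₑ
      = ∫⁻ z in U, ‖fderiv ℝ (stretchIter P p q m n) z - fderiv ℝ (limitMap P p q n) z‖ₑ :=
        (setLIntegral_eq_of_support_subset fun z hz => by_contra fun h => hz (hoff z h)).symm
    _ ≤ ∫⁻ z in U, (‖fderiv ℝ (stretchIter P p q m n) z‖ₑ + ‖fderiv ℝ (limitMap P p q n) z‖ₑ) :=
        lintegral_mono fun z => enorm_sub_le
    _ = (∫⁻ z in U, ‖fderiv ℝ (stretchIter P p q m n) z‖ₑ) +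
          ∫⁻ z in U, ‖fderiv ℝ (limitMap P p q n) z‖ₑ :=
        lintegral_add_left (measurable_fderiv ℝ _).enorm _
    _ ≤ 2 * (levelArea p m + ENNReal.ofReal K * levelArea q m) := by
        rw [two_mul]
        refine add_le_add (lintegral_levelSet_enorm_fderiv_le hK0.le hp1.le hq.le
          (ae_distortionLEAt_stretchIter hK hq hp m n)
          (Function.LeftInverse.injective (stretchIter_stretchIter hp1 hq m n))
          (mapsTo_stretchIter_levelSet hp1.le hq.le m n))
          (lintegral_levelSet_enorm_fderiv_le hK0.le hp1.le hq.le
          (ae_distortionLEAt_limitMap hK hq hp n) (isHomeomorph_limitMap hp1 hq n).injective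
          (mapsTo_limitMap_levelSet hp1.le hq.le m n))

theorem tendstoL1Loc_fderiv_stretchIter (hK : 1 ≤ K) (hq : 1 < q) (hp : p - 1 = K * (q - 1))
    (n : ℕ) : TendstoL1Loc (fun m => fderiv ℝ (stretchIter P p q m n))
      (fderiv ℝ (limitMap P p q n)) := by
  intro S _
  have hp1 : 1 < p := by linarith [mul_pos (one_pos.trans_le hK) (sub_pos.2 hq)]
  have hlim : Tendsto (fun m => 2 * (levelArea p m + ENNReal.ofReal K * levelArea q m)) atTop
      (𝓝 (2 * (0 + ENNReal.ofReal K * 0))) :=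
    ENNReal.Tendsto.const_mul ((tendsto_levelArea hp1).add
      (ENNReal.Tendsto.const_mul (tendsto_levelArea hq) (Or.inr ENNReal.ofReal_ne_top)))
      (Or.inr ENNReal.ofNat_ne_top)
  rw [mul_zero, add_zero, mul_zero] at hlim
  exact tendsto_of_tendsto_of_tendsto_of_le_of_le tendsto_const_nhds hlim (fun _ => zero_le)
    fun m => (setLIntegral_le_lintegral _ _).trans
      (lintegral_enorm_fderiv_stretchIter_sub_le hK hq hp m n)

theorem isQuasiconformal_limitMap (P : ℕ → DiscPacking) (hK : 1 ≤ K) (hq : 1 < q)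
    (hp : p - 1 = K * (q - 1)) (n : ℕ) : IsQuasiconformal K (limitMap P p q n) := by
  have hK0 : 0 < K := one_pos.trans_le hK
  have hp1 : 1 < p := by linarith [mul_pos hK0 (sub_pos.2 hq)]
  have hhom : IsHomeomorph (limitMap P p q n) := isHomeomorph_limitMap hp1 hq n
  have hdist := ae_distortionLEAt_limitMap (P := P) hK hq hp n
  have hL2 := memL2Loc_fderiv_of_ae_distortionLEAt hK0.le hdist hhom.continuous hhom.injective
  have hweak : HasWeakFDeriv (limitMap P p q n) (fderiv ℝ (limitMap P p q n)) :=
    HasWeakFDeriv.of_tendsto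
      (fun m => hasWeakFDeriv_of_lipschitzWith
        (exists_lipschitzWith_stretchIter hp1 hq.le m n).choose_spec)
      (tendstoL1Loc_of_norm_sub_le tendsto_half_pow_mul_two fun m =>
        norm_stretchIter_sub_limitMap_le hp1.le hq.le m n)
      (tendstoL1Loc_fderiv_stretchIter hK hq hp n) hhom.continuous.locallyIntegrable
      hL2.locallyIntegrable
  refine ⟨hhom, orientationPreserving_of_norm_sub_le hhom.continuous hhom.injective
    ((isDiscMap_limitMap hp1.le hq.le n).norm_sub_le_two IsDiscMap.id),
    memL2Loc_of_continuous hhom.continuous, _, hweak, hL2, ?_⟩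
  filter_upwards [hdist] with z hz α β
  exact hz.fderiv.norm_le_mul_norm hK0.le (Complex.norm_exp_ofReal_mul_I α)
    (Complex.norm_exp_ofReal_mul_I β)

end Quasiconformal

section Gauge

theorem IsGaugeFunction.map_zero {h : ℝ≥0 → ℝ≥0} (hh : IsGaugeFunction h) : h 0 = 0 :=
  tendsto_nhds_unique ((hh.continuous.tendsto 0).mono_left nhdsWithin_le_nhds) hh.tendsto_zero

variable {h : ℝ≥0 → ℝ≥0} {s : ℝ}

theorem gaugeHausdorffMeasure_le_mul (hs : 0 < s) (h0 : h 0 = 0)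
    (hlim : Tendsto (fun x : ℝ≥0 => h x / x ^ s) (𝓝[>] 0) (𝓝 0)) {ε : ℝ≥0} (hε : 0 < ε)
    (E : Set ℂ) : gaugeHausdorffMeasure h E ≤ ε * μH[s] E := by
  obtain ⟨δ, hδ, hIoo⟩ := (mem_nhdsGT_iff_exists_Ioo_subset' (zero_lt_one' ℝ≥0)).1
    (hlim.eventually_lt_const hε)
  have hle : (fun x : ℝ≥0∞ => (h x.toNNReal : ℝ≥0∞)) ≤ᶠ[𝓝[≥] 0]
      (ε : ℝ≥0∞) • fun x : ℝ≥0∞ => x ^ s := by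
    filter_upwards [mem_nhdsWithin_of_mem_nhds (Iio_mem_nhds (ENNReal.coe_pos.2 hδ))] with x hx
    lift x to ℝ≥0 using (lt_top_of_lt hx).ne
    rw [Pi.smul_apply, smul_eq_mul, ENNReal.toNNReal_coe, ← ENNReal.coe_rpow_of_nonneg _ hs.le]
    norm_cast
    rcases eq_zero_or_pos x with rfl | hx0
    · rw [h0]; exact zero_le
    · exact ((div_lt_iff₀ (NNReal.rpow_pos hx0)).1 (hIoo ⟨hx0, ENNReal.coe_lt_coe.1 hx⟩)).le
  exact Measure.mkMetric_mono_smul ENNReal.coe_ne_top (ENNReal.coe_ne_zero.2 hε.ne') hle E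

theorem gaugeHausdorffMeasure_eq_zero (hs : 0 < s) (h0 : h 0 = 0)
    (hlim : Tendsto (fun x : ℝ≥0 => h x / x ^ s) (𝓝[>] 0) (𝓝 0)) {E : Set ℂ}
    (hE : μH[s] E < ⊤) : gaugeHausdorffMeasure h E = 0 := by
  have hmul : Tendsto (fun ε : ℝ≥0 => (ε : ℝ≥0∞) * μH[s] E) (𝓝[>] 0) (𝓝 (0 * μH[s] E)) :=
    ENNReal.Tendsto.mul_const
      ((ENNReal.tendsto_coe.2 tendsto_id).mono_left nhdsWithin_le_nhds) (Or.inr hE.ne)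
  rw [zero_mul] at hmul
  exact le_antisymm (ge_of_tendsto hmul (eventually_nhdsWithin_of_forall fun ε hε =>
    gaugeHausdorffMeasure_le_mul hs h0 hlim hε E)) zero_le

end Gauge

theorem corollary3p3_general {K t : ℝ} (hK : 1 ≤ K) (ht₀ : 0 < t) (ht₂ : t < 2) :
    ∃ (E : Set ℂ) (φ : ℂ → ℂ), IsCompact E ∧ IsQuasiconformal K φ ∧
      0 < μH[2 / (K * (2 / t - 1) + 1)] E ∧
      μH[2 / (K * (2 / t - 1) + 1)] E < ⊤ ∧
      0 < μH[t] (φ '' E) ∧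
      μH[t] (φ '' E) < ⊤ ∧
      ∀ h : ℝ≥0 → ℝ≥0, IsGaugeFunction h →
        Tendsto (fun x : ℝ≥0 => h x / x ^ (2 / (K * (2 / t - 1) + 1))) (𝓝[>] 0) (𝓝 0) →
        gaugeHausdorffMeasure h E = 0 := by
  obtain ⟨P, hP⟩ := exists_volume_limitSet_one_pos
  have hq : 1 < 2 / t := (one_lt_div ht₀).2 ht₂
  set p := K * (2 / t - 1) + 1
  have hp : p - 1 = K * (2 / t - 1) := add_sub_cancel_right _ _
  have hp1 : 1 < p := by linarith [mul_pos (one_pos.trans_le hK) (sub_pos.2 hq)]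
  have himage : limitMap P p (2 / t) 0 '' limitSet P p 0 = limitSet P (2 / t) 0 :=
    image_limitMap_limitSet hp1 hq 0
  have hfin : μH[2 / p] (limitSet P p 0) < ⊤ := hausdorffMeasure_limitSet_lt_top hp1.le 0
  have hpos' : 0 < μH[2 / (2 / t)] (limitSet P (2 / t) 0) := hausdorffMeasure_limitSet_pos hq hP
  have hfin' : μH[2 / (2 / t)] (limitSet P (2 / t) 0) < ⊤ :=
    hausdorffMeasure_limitSet_lt_top hq.le 0
  rw [div_div_cancel₀ two_ne_zero, ← himage] at hpos' hfin'
  exact ⟨limitSet P p 0, limitMap P p (2 / t) 0, isCompact_limitSet 0,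
    isQuasiconformal_limitMap P hK hq hp 0, hausdorffMeasure_limitSet_pos hp1 hP, hfin,
    hpos', hfin', fun h hh hlim =>
      gaugeHausdorffMeasure_eq_zero (by positivity) hh.map_zero hlim hfin⟩

theorem corollary3p3 (K : ℝ) (hK : 1 ≤ K) :
    ∃ (E : Set ℂ) (φ : ℂ → ℂ), IsCompact E ∧ IsQuasiconformal K φ ∧
      0 < Measure.hausdorffMeasure (2 / (K + 1)) E ∧
      Measure.hausdorffMeasure (2 / (K + 1)) E < ⊤ ∧
      0 < Measure.hausdorffMeasure 1 (φ '' E) ∧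
      Measure.hausdorffMeasure 1 (φ '' E) < ⊤ ∧
      ∀ h : ℝ≥0 → ℝ≥0, IsGaugeFunction h →
        Tendsto (fun t : ℝ≥0 => h t / t ^ (2 / (K + 1) : ℝ)) (𝓝[>] 0) (𝓝 0) →
        gaugeHausdorffMeasure h E = 0 := by
  have hexp : K * (2 / 1 - 1) + 1 = K + 1 := by ring
  simpa only [hexp] using corollary3p3_general hK one_pos one_lt_two
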